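/- **Theorem 4.3 (extension of Cai–Wu).** Let $P_0$ be a probability measure on $\mathbb R$ without atoms, with distribution function $F_0$ and left-continuous quantile function $F_0^{-1}(u)=\inf\{x: F_0(x)\ge u\}$, and let $(\mu_n)_{n\in\mathbb N}$ be probability measures on $\mathbb R$ that are absolutely continuous with respect to $P_0$; fix a version of each density $\frac{d\mu_n}{dP_0}$. For $\beta\in(\frac12,1]$ put $\varepsilon_n=n^{-\beta}$ and $Q_n=(1-\varepsilon_n)P_0+\varepsilon_n\mu_n$, and consider an i.i.d. sample $X_{n,1},\dots,X_{n,n}$ with joint law $P_0^n$ under $\mathcal H_{0,n}$ and $Q_n^n$ under $\mathcal H_{1,n}$. A sequence of tests *completely separates* $\mathcal H_{0,n}$ and $\mathcal H_{1,n}$ if the sum of its type 1 and type 2 error probabilities tends to $0$ as $n\to\infty$. No sequence of tests *can distinguish* them if this sum tends to $1$ for every sequence of (possibly randomized) tests. The *detection threshold* is the (necessarily unique) number $\beta^\#\in[\frac12,1]$, if it exists, such that for all $\beta\in(\frac12,1]$: if $\beta>\beta^\#$ then no sequence of tests can distinguish $\mathcal H_{0,n}$ and $\mathcal H_{1,n}$;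 if $\beta<\beta^\#$ then some sequence of likelihood ratio tests $\mathbf 1\{dQ_n^n/dP_0^n>c_n\}$ completely separates them. For $s\in\mathbb R$ and $x>0$ let $$\phi_0(x)=x-\log x-1,\quad \phi_1(x)=x(\log x-1)+1,\quad \phi_s(x)=\frac{1-s+sx-x^s}{s(1-s)}\ (s\ne0,1),$$ let $K_s(u,v)=v\,\phi_s\bigl(\tfrac uv\bigr)+(1-v)\,\phi_s\bigl(\tfrac{1-u}{1-v}\bigr)$ for $u,v\in(0,1)$, and let $$S_n(s)=\sup_{X_{1:n}\le x<X_{n:n}}K_s(\mathbb F_n(x),F_0(x)),$$ where $\mathbb F_n$ is the empirical distribution function and $X_{1:n}$, $X_{n:n}$ are the smallest and the largest observation. For $t>0$ and $n\ge2$ let $$h_n(t)=\max\Bigl\{\log\frac{d\mu_n}{dP_0}\bigl(F_0^{-1}(n^{-t})\bigr),\ \log\frac{d\mu_n}{dP_0}\bigl(F_0^{-1}(1-n^{-t})\bigr)\Bigr\}\qquad(\log0=-\infty).$$ Write $\lambda\!\!\lambda$ for Lebesgue measure. Suppose that there is $\beta^*\in\mathbb R$ such that for every $\delta>0$ $$\liminf_{n\to\infty}\lambda\!\!\lambda\Bigl(t\ge\tfrac{\log2}{\log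 n}:\ \beta^*-\delta-\tfrac12\le\tfrac{h_n(t)}{\log n}-t+\tfrac{\min\{t,1\}}2\Bigr)>0$$ and, for all sufficiently large $n$ (depending on $\delta$), $$\lambda\!\!\lambda\Bigl(t\ge\tfrac{\log2}{\log n}:\ \beta^*+\delta-\tfrac12\le\tfrac{h_n(t)}{\log n}-t+\tfrac{\min\{t,1\}}2\Bigr)=0.$$ Let $(\lambda_n)$ be a sequence in $(0,\infty)$ with $\lambda_n\to0$ and $\lambda_nn^\kappa\to\infty$ for all $\kappa>0$. Suppose further that for some $M\ge1$ at least one of the following holds: 1. there is a function $\gamma:(0,\infty)\to\mathbb R$ with $\displaystyle\lim_{n\to\infty}\sup_{t\ge M}\Bigl|\frac{h_n(t)}{\log n}-\gamma(t)\Bigr|=0$; 2. for every $\delta>0$ and all sufficiently large $n$ (depending on $\delta$), $$\lambda\!\!\lambda\Bigl(t\ge M:\ \beta^*+\delta-1\le\tfrac{h_n(t)}{\log n}-\bigl(1-\tfrac{\lambda_n}{\log n}\bigr)t\Bigr)=0.$$ Then the detection threshold exists and $\beta^\#=\beta^*$. Moreover, if $\beta\in(\frac12,1]$ and $\beta<\beta^\#$,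 then for every $s\in\mathbb R$ there is a sequence $(c_n(s))_{n\in\mathbb N}$ of critical values such that the tests $\varphi_n=\mathbf 1\{S_n(s)>c_n(s)\}$ completely separate $\mathcal H_{0,n}$ and $\mathcal H_{1,n}$ asymptotically. -/

import Mathlib

open MeasureTheory ProbabilityTheory Filter Topology Set
open scoped ENNReal NNReal

namespace SparseMixture

noncomputable section

/-- The convex function `φ_s`; it is only evaluated at `x > 0`. -/
def phi (s x : ℝ) : ℝ :=
  if s = 0 then x - Real.log x - 1
  else if s = 1 then x * (Real.log x - 1) + 1
  else (1 - s + s * x - x ^ s) / (s * (1 - s))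

/-- The divergence `K_s(u, v)`, meant for `u, v ∈ (0, 1)`. -/
def K (s u v : ℝ) : ℝ :=
  v * phi s (u / v) + (1 - v) * phi s ((1 - u) / (1 - v))

/-- The empirical distribution function of the sample `x = (x_1, …, x_n)`. -/
def empCdf {n : ℕ} (x : Fin n → ℝ) (y : ℝ) : ℝ :=
  ((Finset.univ.filter fun i => x i ≤ y).card : ℝ) / n

/-- The statistic `S_n(s)`: the supremum of `K_s(𝔽_n(y), F_0(y))` over all `y` with
`X_{1:n} ≤ y < X_{n:n}`, where `X_{1:n}` is the smallest and `X_{n:n}` the largest observation. -/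
def S (P₀ : Measure ℝ) (s : ℝ) {n : ℕ} (x : Fin n → ℝ) : EReal :=
  ⨆ y ∈ Ico (⨅ i, x i) (⨆ i, x i), ((K s (empCdf x y) (cdf P₀ y) : ℝ) : EReal)

/-- The left-continuous quantile function `F_0⁻¹(u) = inf {x : F_0(x) ≥ u}`, for `u ∈ (0, 1)`. -/
def quantile (P₀ : Measure ℝ) (u : ℝ) : ℝ := sInf {x : ℝ | u ≤ cdf P₀ x}

/-- `h_n(t) = max {log f_n(F_0⁻¹(n⁻ᵗ)), log f_n(F_0⁻¹(1 - n⁻ᵗ))}`, where `f_n` is the density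
of `μ_n` with respect to `P_0`. It takes values in `[-∞, ∞]`, with `log 0 = -∞`. -/
def h (P₀ : Measure ℝ) (f : ℕ → ℝ → ℝ≥0∞) (n : ℕ) (t : ℝ) : EReal :=
  max (ENNReal.log (f n (quantile P₀ ((n : ℝ) ^ (-t)))))
    (ENNReal.log (f n (quantile P₀ (1 - (n : ℝ) ^ (-t)))))

/-- The law `P_0^n` of the sample of size `n` under the null. -/
def nullLaw (P₀ : Measure ℝ) (n : ℕ) : Measure (Fin n → ℝ) :=
  Measure.pi fun _ => P₀

/-- The law `Q_n^n` of the sample of size `n` under the alternative, where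
`Q_n = (1 - ε_n) P_0 + ε_n μ_n` and `ε_n = n^(-β)`. -/
def altLaw (P₀ : Measure ℝ) (μ : ℕ → Measure ℝ) (β : ℝ) (n : ℕ) : Measure (Fin n → ℝ) :=
  Measure.pi fun _ =>
    ENNReal.ofReal (1 - (n : ℝ) ^ (-β)) • P₀ + ENNReal.ofReal ((n : ℝ) ^ (-β)) • μ n

/-- The nonrandomized tests with rejection regions `R_n` completely separate null and alternative
asymptotically: the sum of the type 1 and type 2 error probabilities tends to `0`. -/
def CompletelySeparates (P₀ : Measure ℝ) (μ : ℕ → Measure ℝ) (β : ℝ)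
    (R : (n : ℕ) → Set (Fin n → ℝ)) : Prop :=
  Tendsto (fun n => nullLaw P₀ n (R n) + altLaw P₀ μ β n (R n)ᶜ) atTop (𝓝 0)

/-- No sequence of (possibly randomized) tests can distinguish null and alternative
asymptotically: the sum of the error probabilities tends to `1` for every sequence of tests. -/
def Undetectable (P₀ : Measure ℝ) (μ : ℕ → Measure ℝ) (β : ℝ) : Prop :=
  ∀ φ : (n : ℕ) → (Fin n → ℝ) → ℝ,
    (∀ n, Measurable (φ n)) → (∀ n x, φ n x ∈ Icc (0 : ℝ) 1) →
    Tendsto (fun n => ∫ x, φ n x ∂(nullLaw P₀ n) + ∫ x, (1 - φ n x) ∂(altLaw P₀ μ β n))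
      atTop (𝓝 1)

/-- Some sequence of likelihood ratio tests `1{dQ_n^n / dP_0^n > c_n}` completely separates
null and alternative asymptotically (for signal distributions dominated by `P_0`). -/
def LRDetectable (P₀ : Measure ℝ) (μ : ℕ → Measure ℝ) (β : ℝ) : Prop :=
  ∃ c : ℕ → ℝ≥0, CompletelySeparates P₀ μ β fun n =>
    {x | (c n : ℝ≥0∞) < (altLaw P₀ μ β n).rnDeriv (nullLaw P₀ n) x}

/-- `b` is the detection threshold for the parameter `β ∈ (1/2, 1]`. At most one `b ∈ [1/2, 1]`
has this property. -/
structure IsDetectionThreshold (P₀ : Measure ℝ) (μ : ℕ → Measure ℝ) (b : ℝ) : Prop where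
  mem : b ∈ Icc (1 / 2 : ℝ) 1
  undetectable : ∀ β ∈ Ioc (1 / 2 : ℝ) 1, b < β → Undetectable P₀ μ β
  detectable : ∀ β ∈ Ioc (1 / 2 : ℝ) 1, β < b → LRDetectable P₀ μ β

end

end SparseMixture

/-!
Substitute `u = F₀(x)` and then `u = n ^ (-t)` or `u = 1 - n ^ (-t)`. Since `P₀` has no atoms, it is
the law of its quantile function under the uniform distribution, and `lintegral_eq_quantile`
turns a `P₀`-integral into an integral over `t ≥ log 2 / log n` with weight `n ^ (-t) log n`. The
hypotheses on `h` become two-sided bounds by powers of `n` for `peak`, the larger of the two values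
of the density at these quantiles. The threshold `b` lies in `[1/2, 1]` because a density has total
mass one.

*Above the threshold* (`undetectable_of_upper_bounds`), let `A` be the region between the quantiles
of orders `1 / n` and `1 - 1 / n`. The signal outside `A` has mass `o(n ^ (β - 1))` and is discarded
by domination; on `A` the density `g` satisfies `n ε ^ 2 ∫_A g ^ 2 → 0`, so that the truncated
likelihood ratio tends to `1` in `L²` (`abs_error_sum_mixture_le`). The mass at `t ≥ M` needs
a separate argument: either exponential damping (`tail_of_damping`), or comparison of the index `n`
with a fixed index `N` by means of the limit function `γ` (`tail_of_uniform`).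

*Below the threshold*, a pigeonhole argument over the exponents `t` produces a half-line of null
probability `v ∈ [1 / n, 1 / 2]` whose expected count under the alternative exceeds `n v` by at
least `n ^ κ √(n v)` (`eventually_signal`). Counts concentrate by Chernoff's inequality
(`count_deviation`). Under the null a union bound over the grid `{F₀ < k / n}` keeps all counts
within `b √max(n v, 1)` of their means with `b` a small power of `n`; since
`φ_s''(x) = x ^ (s - 2)`, the divergence is quadratic near `1` up to powers of `b`, and `S_n(s)`
is at most `n ^ (-1 + κ / 2)` up to a constant (`null_statistic_bound`). Under the alternative the
excess at the half-line makes `S_n(s)` at least of order `n ^ (-1 + κ)` (`alt_statistic_bound`). The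
likelihood ratio test with critical value `1` is then at least as good (`likelihood_ratio_optimal`).
-/

namespace SparseMixture

/-! ### The quantile transformation -/

section Quantile

variable {P₀ : Measure ℝ}

lemma quantile_set_bddBelow {u : ℝ} (hu : 0 < u) : BddBelow {x : ℝ | u ≤ cdf P₀ x} := by
  obtain ⟨y, hy⟩ := ((tendsto_cdf_atBot P₀).eventually_lt_const hu).exists
  refine ⟨y, fun x hx => ?_⟩
  by_contra hlt
  exact absurd (hx.trans (monotone_cdf P₀ (not_le.1 hlt).le)) (not_le.2 hy)

lemma quantile_set_nonempty {u : ℝ} (hu : u < 1) : {x : ℝ | u ≤ cdf P₀ x}.Nonempty := by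
  obtain ⟨y, hy⟩ := ((tendsto_cdf_atTop P₀).eventually_const_lt hu).exists
  exact ⟨y, hy.le⟩

/-- The Galois connection between quantile and distribution function. -/
lemma quantile_le_iff {u x : ℝ} (hu : u ∈ Ioo (0 : ℝ) 1) :
    quantile P₀ u ≤ x ↔ u ≤ cdf P₀ x := by
  refine ⟨fun hx => ?_, fun hx => csInf_le (quantile_set_bddBelow hu.1) hx⟩
  have hright : Tendsto (cdf P₀) (𝓝[>] x) (𝓝 (cdf P₀ x)) :=
    ((cdf P₀).right_continuous x).tendsto.mono_left (nhdsWithin_mono _ Ioi_subset_Ici_self)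
  refine ge_of_tendsto hright ?_
  filter_upwards [self_mem_nhdsWithin] with y hy
  obtain ⟨z, hz, hzy⟩ := exists_lt_of_csInf_lt (quantile_set_nonempty hu.2)
    (lt_of_le_of_lt hx hy : sInf {x : ℝ | u ≤ cdf P₀ x} < y)
  exact le_trans hz (monotone_cdf P₀ hzy.le)

lemma quantile_mono {u v : ℝ} (hu : u ∈ Ioo (0 : ℝ) 1) (hv : v ∈ Ioo (0 : ℝ) 1) (huv : u ≤ v) :
    quantile P₀ u ≤ quantile P₀ v :=
  (quantile_le_iff hu).2 (huv.trans ((quantile_le_iff hv).1 le_rfl))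

/-- Outside `(0, 1)` the infimum in the definition of the quantile function takes junk values; it
is constant on `(-∞, 0]` and on `(1, ∞)`, so measurability holds on the whole line. -/
lemma measurable_quantile : Measurable (quantile P₀) := by
  have h0 : ∀ u ≤ 0, quantile P₀ u = 0 := fun u hu => by
    have : {x : ℝ | u ≤ cdf P₀ x} = univ := by
      ext x; simpa using hu.trans (cdf_nonneg P₀ x)
    rw [quantile, this, Real.sInf_univ]
  have h1 : ∀ u, 1 < u → quantile P₀ u = 0 := fun u hu => by
    have : {x : ℝ | u ≤ cdf P₀ x} = ∅ := by
      ext x; simpa using (cdf_le_one P₀ x).trans_lt hu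
    rw [quantile, this, Real.sInf_empty]
  have hm : Measurable ((Ioo (0 : ℝ) 1).domRestrict (quantile P₀)) :=
    Monotone.measurable fun u v huv => quantile_mono u.2 v.2 huv
  have hc : Measurable ((Ioo (0 : ℝ) 1)ᶜ.domRestrict (quantile P₀)) := by
    have : (Ioo (0 : ℝ) 1)ᶜ.domRestrict (quantile P₀)
        = (fun u : ℝ => if u = 1 then quantile P₀ 1 else 0) ∘ ((↑) : ↥(Ioo (0 : ℝ) 1)ᶜ → ℝ) := by
      ext ⟨u, hu⟩
      change quantile P₀ u = if u = 1 then quantile P₀ 1 else 0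
      split_ifs with h
      · rw [h]
      · rcases le_or_gt u 0 with hu0 | hu0
        · exact h0 u hu0
        · refine h1 u (lt_of_le_of_ne ?_ (Ne.symm h))
          by_contra hlt
          exact hu ⟨hu0, not_le.1 hlt⟩
    rw [this]
    exact (Measurable.ite (measurableSet_singleton 1) measurable_const measurable_const).comp
      measurable_subtype_coe
  exact measurable_of_restrict_of_restrict_compl measurableSet_Ioo hm hc

variable [IsProbabilityMeasure P₀]

lemma map_quantile : (volume.restrict (Ioo (0 : ℝ) 1)).map (quantile P₀) = P₀ := by
  have : IsFiniteMeasure ((volume.restrict (Ioo (0 : ℝ) 1)).map (quantile P₀)) := by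
    infer_instance
  refine Measure.ext_of_Iic _ _ fun x => ?_
  rw [Measure.map_apply measurable_quantile measurableSet_Iic,
    Measure.restrict_apply (measurable_quantile measurableSet_Iic), ← ofReal_cdf]
  have h0 := cdf_nonneg P₀ x
  have h1 := cdf_le_one P₀ x
  have hset : quantile P₀ ⁻¹' Iic x ∩ Ioo 0 1 = Ioc 0 (cdf P₀ x) ∩ Ioo 0 1 := by
    ext u
    simp only [mem_inter_iff, mem_preimage, mem_Iic, mem_Ioc]
    constructor
    · rintro ⟨h, hu⟩; exact ⟨⟨hu.1, (quantile_le_iff hu).1 h⟩, hu⟩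
    · rintro ⟨h, hu⟩; exact ⟨(quantile_le_iff hu).2 h.2, hu⟩
  rw [hset]
  apply le_antisymm
  · refine (measure_mono inter_subset_left).trans ?_
    rw [Real.volume_Ioc, sub_zero]
  · have : Ioo 0 (cdf P₀ x) ⊆ Ioc 0 (cdf P₀ x) ∩ Ioo 0 1 := fun u hu =>
      ⟨Ioo_subset_Ioc_self hu, hu.1, hu.2.trans_le h1⟩
    refine le_trans ?_ (measure_mono this)
    rw [Real.volume_Ioo, sub_zero]

lemma measure_eq_volume_quantile {A : Set ℝ} (hA : MeasurableSet A) :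
    P₀ A = volume (quantile P₀ ⁻¹' A ∩ Ioo 0 1) := by
  have h := congrArg (fun ν : Measure ℝ => ν A) (map_quantile (P₀ := P₀))
  rw [← h, Measure.map_apply measurable_quantile hA,
    Measure.restrict_apply (measurable_quantile hA)]

lemma continuous_cdf_of_nullSingleton [NullSingletonClass P₀] : Continuous (cdf P₀) := by
  refine continuous_iff_continuousAt.2 fun x => ?_
  rw [(monotone_cdf P₀).continuousAt_iff_leftLim_eq_rightLim, StieltjesFunction.rightLim_eq]
  have h := (cdf P₀).measure_singleton x
  rw [measure_cdf, measure_singleton] at h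
  have h2 := ENNReal.ofReal_eq_zero.1 h.symm
  exact le_antisymm ((monotone_cdf P₀).leftLim_le le_rfl) (by linarith)

lemma cdf_quantile [NullSingletonClass P₀] {u : ℝ} (hu : u ∈ Ioo (0 : ℝ) 1) :
    cdf P₀ (quantile P₀ u) = u := by
  refine le_antisymm ?_ ((quantile_le_iff hu).1 le_rfl)
  have hc := (continuous_cdf_of_nullSingleton (P₀ := P₀)).tendsto (quantile P₀ u)
  refine le_of_tendsto (hc.mono_left (nhdsWithin_le_nhds (s := Iio (quantile P₀ u)))) ?_
  filter_upwards [self_mem_nhdsWithin] with y hy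
  by_contra hlt
  exact absurd ((quantile_le_iff hu).2 (not_le.1 hlt).le) (not_le.2 hy)

lemma measure_cdf_lt [NullSingletonClass P₀] {w : ℝ} (h1 : w ≤ 1) :
    P₀ {x | cdf P₀ x < w} = ENNReal.ofReal w := by
  have hm : MeasurableSet {x | cdf P₀ x < w} :=
    measurableSet_lt (monotone_cdf P₀).measurable measurable_const
  rw [measure_eq_volume_quantile hm]
  have : quantile P₀ ⁻¹' {x | cdf P₀ x < w} ∩ Ioo 0 1 = Ioo 0 w := by
    ext u
    simp only [mem_inter_iff, mem_preimage, mem_ofPred_eq]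
    constructor
    · rintro ⟨h, hu⟩; rw [cdf_quantile hu] at h; exact ⟨hu.1, h⟩
    · intro hu
      have hu' : u ∈ Ioo (0 : ℝ) 1 := ⟨hu.1, hu.2.trans_le h1⟩
      exact ⟨by rw [cdf_quantile hu']; exact hu.2, hu'⟩
  rw [this, Real.volume_Ioo, sub_zero]

lemma measure_lt_cdf [NullSingletonClass P₀] {w : ℝ} (h1 : w ≤ 1) :
    P₀ {x | 1 - w < cdf P₀ x} = ENNReal.ofReal w := by
  have hm : MeasurableSet {x | 1 - w < cdf P₀ x} :=
    measurableSet_lt measurable_const (monotone_cdf P₀).measurable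
  rw [measure_eq_volume_quantile hm]
  have : quantile P₀ ⁻¹' {x | 1 - w < cdf P₀ x} ∩ Ioo 0 1 = Ioo (1 - w) 1 := by
    ext u
    simp only [mem_inter_iff, mem_preimage, mem_ofPred_eq]
    constructor
    · rintro ⟨h, hu⟩; rw [cdf_quantile hu] at h; exact ⟨h, hu.2⟩
    · intro hu
      have hu' : u ∈ Ioo (0 : ℝ) 1 := ⟨by linarith [hu.1], hu.2⟩
      exact ⟨by rw [cdf_quantile hu']; exact hu.1, hu'⟩
  rw [this, Real.volume_Ioo]
  congr 1; ring

lemma rpow_neg_mem_Ioc {x t : ℝ} (hx : 1 < x) (ht : Real.log 2 / Real.log x ≤ t) :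
    x ^ (-t) ∈ Ioc (0 : ℝ) (1 / 2) := by
  have hL := Real.log_pos hx
  refine ⟨Real.rpow_pos_of_pos (by linarith) _, ?_⟩
  rw [div_le_iff₀ hL] at ht
  rw [Real.rpow_def_of_pos (by linarith), ← Real.exp_log (show (0 : ℝ) < 1 / 2 by norm_num)]
  refine Real.exp_le_exp.2 ?_
  rw [one_div, Real.log_inv]
  linarith

/-- Substitution `u = x ^ (-t)` in the left half of the unit interval and `u = 1 - x ^ (-t)` in the
right half. -/
lemma lintegral_eq_quantile {x : ℝ} (hx : 1 < x) {G : ℝ → ℝ≥0∞} (hG : Measurable G) :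
    ∫⁻ y, G y ∂P₀ = ∫⁻ t in Ici (Real.log 2 / Real.log x),
      ENNReal.ofReal (Real.log x * x ^ (-t)) *
        (G (quantile P₀ (x ^ (-t))) + G (quantile P₀ (1 - x ^ (-t)))) := by
  have hx0 : 0 < x := by linarith
  have hL := Real.log_pos hx
  set a := Real.log 2 / Real.log x with ha
  have hGq : Measurable fun u => G (quantile P₀ u) := hG.comp measurable_quantile
  have hpow : Measurable fun t : ℝ => x ^ (-t) := by fun_prop
  have hderiv : ∀ t : ℝ, HasDerivAt (fun t : ℝ => x ^ (-t)) (-(Real.log x * x ^ (-t))) t := by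
    intro t
    have := (hasDerivAt_id t).neg.const_rpow hx0
    rw [mul_neg_one, neg_mul] at this
    exact this
  have hinj : Function.Injective fun t : ℝ => x ^ (-t) := fun s t hst => by
    have := (Real.rpow_right_inj hx0 hx.ne').1 hst
    linarith
  have habs : ∀ t : ℝ, |-(Real.log x * x ^ (-t))| = Real.log x * x ^ (-t) := fun t => by
    rw [abs_neg, abs_of_pos (mul_pos hL (Real.rpow_pos_of_pos hx0 _))]
  have himage : (fun t : ℝ => x ^ (-t)) '' Ici a = Ioc 0 (1 / 2) := by
    ext u
    constructor
    · rintro ⟨t, ht, rfl⟩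
      exact rpow_neg_mem_Ioc hx ht
    · intro hu
      refine ⟨-(Real.log u / Real.log x), ?_, ?_⟩
      · rw [mem_Ici, ha, ← neg_div, div_le_div_iff_of_pos_right hL]
        have := Real.log_le_log hu.1 hu.2
        rw [one_div, Real.log_inv] at this
        linarith
      · simp only [neg_neg]
        rw [Real.rpow_def_of_pos hx0, mul_div_cancel₀ _ hL.ne', Real.exp_log hu.1]
  have himage' : (fun t : ℝ => 1 - x ^ (-t)) '' Ici a = Ico (1 / 2) 1 := by
    rw [show (fun t : ℝ => 1 - x ^ (-t)) = (fun u => 1 - u) ∘ fun t : ℝ => x ^ (-t) from rfl,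
      image_comp, himage, image_const_sub_Ioc]
    norm_num
  have e1 := lintegral_image_eq_lintegral_abs_deriv_mul (s := Ici a) measurableSet_Ici
    (fun t _ => (hderiv t).hasDerivWithinAt) hinj.injOn (fun u => G (quantile P₀ u))
  have e2 := lintegral_image_eq_lintegral_abs_deriv_mul (s := Ici a) measurableSet_Ici
    (fun t _ => ((hderiv t).const_sub 1).hasDerivWithinAt)
    (fun s _ t _ hst => hinj (by simpa using hst)) (fun u => G (quantile P₀ u))
  rw [himage] at e1
  rw [himage'] at e2
  simp only [habs, neg_neg] at e1 e2
  simp only [abs_of_pos (mul_pos hL (Real.rpow_pos_of_pos hx0 _))] at e2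
  simp only [mul_add]
  rw [lintegral_add_left (by exact (hpow.const_mul _).ennreal_ofReal.mul (hGq.comp hpow)),
    ← e1, ← e2]
  have hmap : ∫⁻ y, G y ∂P₀ = ∫⁻ u in Ioo (0 : ℝ) 1, G (quantile P₀ u) := by
    rw [← lintegral_map hG measurable_quantile, map_quantile]
  rw [hmap]
  have hunion : Ioo (0 : ℝ) 1 = Ioc 0 (1 / 2) ∪ Ioo (1 / 2) 1 := by
    rw [Ioc_union_Ioo_eq_Ioo] <;> norm_num
  rw [hunion, lintegral_union measurableSet_Ioo, setLIntegral_congr Ioo_ae_eq_Ico]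
  exact Set.disjoint_left.2 fun u hu hu' => absurd hu'.1 (not_lt.2 hu.2)

end Quantile

/-! ### Quadratic bounds for the divergence -/

/-- The derivative of `phi s` on `(0, ∞)`. -/
noncomputable def phiDeriv (s x : ℝ) : ℝ :=
  if s = 1 then Real.log x else (1 - x ^ (s - 1)) / (1 - s)

lemma hasDerivAt_phi (s : ℝ) {x : ℝ} (hx : 0 < x) : HasDerivAt (phi s) (phiDeriv s x) x := by
  unfold phi phiDeriv
  have hlog := Real.hasDerivAt_log hx.ne'
  have hid := hasDerivAt_id' x
  by_cases h0 : s = 0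
  · subst h0
    simp only [if_true]
    refine ((hid.sub hlog).sub_const 1).congr_deriv ?_
    norm_num [Real.rpow_neg_one]
  · by_cases h1 : s = 1
    · subst h1
      simp only [if_true, if_neg h0]
      refine ((hid.mul (hlog.sub_const 1)).add_const 1).congr_deriv ?_
      field_simp
      ring
    · simp only [if_neg h0, if_neg h1]
      have h1' : 1 - s ≠ 0 := sub_ne_zero.2 (Ne.symm h1)
      have := (((hid.const_mul s).const_add (1 - s)).sub
        (Real.hasDerivAt_rpow_const (p := s) (Or.inl hx.ne'))).div_const (s * (1 - s))
      refine this.congr_deriv ?_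
      field_simp

lemma hasDerivAt_phiDeriv (s : ℝ) {x : ℝ} (hx : 0 < x) :
    HasDerivAt (phiDeriv s) (x ^ (s - 2)) x := by
  unfold phiDeriv
  by_cases h1 : s = 1
  · subst h1
    simp only [if_true]
    refine (Real.hasDerivAt_log hx.ne').congr_deriv ?_
    rw [← Real.rpow_neg_one]; norm_num
  · simp only [if_neg h1]
    have h1' : 1 - s ≠ 0 := sub_ne_zero.2 (Ne.symm h1)
    have := ((Real.hasDerivAt_rpow_const (p := s - 1) (Or.inl hx.ne')).const_sub 1).div_const
      (1 - s)
    refine this.congr_deriv ?_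
    rw [div_eq_iff h1', show s - 1 - 1 = s - 2 by ring]; ring

lemma phi_one (s : ℝ) : phi s 1 = 0 := by
  unfold phi; split_ifs <;> simp

lemma phiDeriv_one (s : ℝ) : phiDeriv s 1 = 0 := by
  unfold phiDeriv; split_ifs <;> simp

/-- A function with a stationary zero at `1` and nonnegative second derivative is nonnegative. -/
lemma nonneg_of_second_deriv_nonneg {D : Set ℝ} (hD : Convex ℝ D) (h1 : (1 : ℝ) ∈ D)
    {F F' F'' : ℝ → ℝ} (hF : ∀ x ∈ D, HasDerivAt F (F' x) x)
    (hF' : ∀ x ∈ D, HasDerivAt F' (F'' x) x) (hF'' : ∀ x ∈ D, 0 ≤ F'' x)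
    (hF1 : F 1 = 0) (hF'1 : F' 1 = 0) {x : ℝ} (hx : x ∈ D) : 0 ≤ F x := by
  have hmono : MonotoneOn F' D := monotoneOn_of_deriv_nonneg hD
    (fun y hy => (hF' y hy).continuousAt.continuousWithinAt)
    (fun y hy => (hF' y (interior_subset hy)).differentiableAt.differentiableWithinAt)
    (fun y hy => by rw [(hF' y (interior_subset hy)).deriv]; exact hF'' y (interior_subset hy))
  rcases le_total 1 x with h | h
  · have hsub : Icc 1 x ⊆ D := hD.ordConnected.out h1 hx
    have : MonotoneOn F (Icc 1 x) := monotoneOn_of_deriv_nonneg (convex_Icc _ _)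
      (fun y hy => (hF y (hsub hy)).continuousAt.continuousWithinAt)
      (fun y hy => (hF y (hsub (interior_subset hy))).differentiableAt.differentiableWithinAt)
      (fun y hy => by
        have hy := interior_subset hy
        rw [(hF y (hsub hy)).deriv, ← hF'1]
        exact hmono h1 (hsub hy) hy.1)
    rw [← hF1]
    exact this ⟨le_rfl, h⟩ ⟨h, le_rfl⟩ h
  · have hsub : Icc x 1 ⊆ D := hD.ordConnected.out hx h1
    have : AntitoneOn F (Icc x 1) := antitoneOn_of_deriv_nonpos (convex_Icc _ _)
      (fun y hy => (hF y (hsub hy)).continuousAt.continuousWithinAt)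
      (fun y hy => (hF y (hsub (interior_subset hy))).differentiableAt.differentiableWithinAt)
      (fun y hy => by
        have hy := interior_subset hy
        rw [(hF y (hsub hy)).deriv, ← hF'1]
        exact hmono (hsub hy) h1 hy.2)
    rw [← hF1]
    exact this ⟨le_rfl, h⟩ ⟨h, le_rfl⟩ h

lemma hasDerivAt_quadratic (c x : ℝ) :
    HasDerivAt (fun x : ℝ => c / 2 * (x - 1) ^ 2) (c * (x - 1)) x := by
  refine ((((hasDerivAt_id' x).sub_const 1).pow 2).const_mul (c / 2)).congr_deriv ?_
  norm_num; ring

lemma hasDerivAt_linear (c x : ℝ) : HasDerivAt (fun x : ℝ => c * (x - 1)) c x := by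
  refine (((hasDerivAt_id' x).sub_const 1).const_mul c).congr_deriv ?_
  ring

lemma quadratic_le_phi {s c : ℝ} {D : Set ℝ} (hD : Convex ℝ D) (h1 : (1 : ℝ) ∈ D)
    (hpos : ∀ x ∈ D, 0 < x) (hc : ∀ x ∈ D, c ≤ x ^ (s - 2)) {x : ℝ} (hx : x ∈ D) :
    c / 2 * (x - 1) ^ 2 ≤ phi s x := by
  have := nonneg_of_second_deriv_nonneg hD h1 (F := fun x => phi s x - c / 2 * (x - 1) ^ 2)
    (F' := fun x => phiDeriv s x - c * (x - 1)) (F'' := fun x => x ^ (s - 2) - c)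
    (fun x hx => (hasDerivAt_phi s (hpos x hx)).sub (hasDerivAt_quadratic c x))
    (fun x hx => (hasDerivAt_phiDeriv s (hpos x hx)).sub (hasDerivAt_linear c x))
    (fun x hx => sub_nonneg.2 (hc x hx)) (by simp [phi_one]) (by simp [phiDeriv_one]) hx
  linarith

lemma phi_le_quadratic {s c : ℝ} {D : Set ℝ} (hD : Convex ℝ D) (h1 : (1 : ℝ) ∈ D)
    (hpos : ∀ x ∈ D, 0 < x) (hc : ∀ x ∈ D, x ^ (s - 2) ≤ c) {x : ℝ} (hx : x ∈ D) :
    phi s x ≤ c / 2 * (x - 1) ^ 2 := by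
  have := nonneg_of_second_deriv_nonneg hD h1 (F := fun x => c / 2 * (x - 1) ^ 2 - phi s x)
    (F' := fun x => c * (x - 1) - phiDeriv s x) (F'' := fun x => c - x ^ (s - 2))
    (fun x hx => (hasDerivAt_quadratic c x).sub (hasDerivAt_phi s (hpos x hx)))
    (fun x hx => (hasDerivAt_linear c x).sub (hasDerivAt_phiDeriv s (hpos x hx)))
    (fun x hx => sub_nonneg.2 (hc x hx)) (by simp [phi_one]) (by simp [phiDeriv_one]) hx
  linarith

lemma phi_nonneg (s : ℝ) {x : ℝ} (hx : 0 < x) : 0 ≤ phi s x := by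
  have := quadratic_le_phi (s := s) (c := 0) (convex_Ioi 0) (by simp)
    (fun x hx => hx) (fun x hx => (Real.rpow_pos_of_pos hx _).le) (mem_Ioi.2 hx)
  linarith

lemma phi_le_of_ratio {s R x : ℝ} (hR : 1 ≤ R) (hx : R⁻¹ ≤ x) (hx' : x ≤ R) :
    phi s x ≤ R ^ |s - 2| / 2 * (x - 1) ^ 2 := by
  have hR0 : 0 < R := by linarith
  have hRi : 0 < R⁻¹ := inv_pos.2 hR0
  refine phi_le_quadratic (convex_Icc R⁻¹ R) ⟨inv_le_one_of_one_le₀ hR, hR⟩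
    (fun y hy => hRi.trans_le hy.1) (fun y hy => ?_) ⟨hx, hx'⟩
  have hy0 := hRi.trans_le hy.1
  rcases le_total 0 (s - 2) with h | h
  · rw [abs_of_nonneg h]; exact Real.rpow_le_rpow hy0.le hy.2 h
  · rw [abs_of_nonpos h, Real.rpow_neg hR0.le, ← Real.inv_rpow hR0.le]
    exact Real.rpow_le_rpow_of_nonpos hRi hy.1 h

lemma convexOn_phi (s : ℝ) : ConvexOn ℝ (Ioi 0) (phi s) := by
  have hmono : MonotoneOn (phiDeriv s) (Ioi 0) := monotoneOn_of_deriv_nonneg (convex_Ioi 0)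
    (fun y hy => (hasDerivAt_phiDeriv s hy).continuousAt.continuousWithinAt)
    (fun y hy =>
      (hasDerivAt_phiDeriv s (interior_subset hy)).differentiableAt.differentiableWithinAt)
    (fun y hy => by
      have hy : 0 < y := interior_subset hy
      rw [(hasDerivAt_phiDeriv s hy).deriv]; positivity)
  refine MonotoneOn.convexOn_of_deriv (convex_Ioi 0)
    (fun y hy => (hasDerivAt_phi s hy).continuousAt.continuousWithinAt)
    (fun y hy => (hasDerivAt_phi s (interior_subset hy)).differentiableAt.differentiableWithinAt) ?_
  rw [interior_Ioi]
  exact hmono.congr fun y hy => ((hasDerivAt_phi s hy).deriv).symm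

/-- To the right of `1`, `phi s` dominates a multiple of `min ρ ρ²`, whatever `s` is. -/
lemma exists_phi_lower (s : ℝ) : ∃ c : ℝ, 0 < c ∧
    ∀ ρ x : ℝ, 0 ≤ ρ → 1 + ρ ≤ x → c * min ρ (ρ ^ 2) ≤ phi s x := by
  set c : ℝ := min 1 (2 ^ (s - 2)) with hc
  have hc0 : 0 < c := lt_min one_pos (by positivity)
  have hquad : ∀ x ∈ Icc (1 : ℝ) 2, c / 2 * (x - 1) ^ 2 ≤ phi s x := fun x hx => by
    refine quadratic_le_phi (convex_Icc 1 2) ⟨le_rfl, by norm_num⟩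
      (fun y hy => by linarith [hy.1]) (fun y hy => ?_) hx
    rcases le_total 0 (s - 2) with h | h
    · exact (min_le_left _ _).trans (Real.one_le_rpow hy.1 h)
    · exact (min_le_right _ _).trans
        (Real.rpow_le_rpow_of_nonpos (by linarith [hy.1]) hy.2 h)
  have hstep : ∀ ρ : ℝ, 0 ≤ ρ → c / 2 * min ρ (ρ ^ 2) ≤ phi s (1 + ρ) := by
    intro ρ hρ
    rcases le_total ρ 1 with h | h
    · refine le_trans ?_ (hquad (1 + ρ) ⟨by linarith, by linarith⟩)
      gcongr
      rw [add_sub_cancel_left]; exact min_le_right _ _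
    · have h2 := hquad 2 ⟨by norm_num, le_rfl⟩
      have hρ0 : 0 < ρ := by linarith
      -- `2` is a convex combination of `1` and `1 + ρ`
      have hconv := (convexOn_phi s).2 (mem_Ioi.2 one_pos)
        (mem_Ioi.2 (show 0 < 1 + ρ by linarith))
        (sub_nonneg.2 (inv_le_one_of_one_le₀ h)) (inv_nonneg.2 hρ) (sub_add_cancel _ _)
      simp only [smul_eq_mul, phi_one, mul_zero, zero_add] at hconv
      rw [show (1 - ρ⁻¹) * 1 + ρ⁻¹ * (1 + ρ) = 2 by field_simp; ring] at hconv
      have h3 : ρ * (c / 2) ≤ ρ * (ρ⁻¹ * phi s (1 + ρ)) :=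
        mul_le_mul_of_nonneg_left (by linarith) hρ
      rw [mul_inv_cancel_left₀ hρ0.ne'] at h3
      calc c / 2 * min ρ (ρ ^ 2) ≤ c / 2 * ρ := by gcongr; exact min_le_left _ _
        _ ≤ _ := by linarith
  refine ⟨c / 2, by positivity, fun ρ x hρ hx => ?_⟩
  refine le_trans ?_ (show phi s (1 + (x - 1)) ≤ phi s x by rw [add_sub_cancel])
  refine le_trans ?_ (hstep (x - 1) (by linarith))
  gcongr <;> linarith

/-- Binomial counts: if `N ≥ 1` and its mean `m` are at distance `O(b √max(m, 1))`, then the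
contribution `m φ_s(N / m)` to the divergence is at most a power of `b`. -/
lemma mul_phi_ratio_le (s : ℝ) {b N m : ℝ} (hb : 38 ≤ b) (hN : 1 ≤ N) (hm : b⁻¹ ≤ m)
    (hdev : |N - m| ≤ 3 * b * √(max m 1)) :
    m * phi s (N / m) ≤ b ^ (5 + 3 * |s - 2|) := by
  have hb0 : 0 < b := by linarith
  have hm0 : 0 < m := (inv_pos.2 hb0).trans_le hm
  have hN0 : 0 < N := by linarith
  have hbm : 1 ≤ b * m := by
    have := mul_le_mul_of_nonneg_left hm hb0.le
    rwa [mul_inv_cancel₀ hb0.ne'] at this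
  have hmax : max m 1 ≤ b * m := max_le (by nlinarith) hbm
  have hmax1 : 1 ≤ max m 1 := le_max_right _ _
  have hdev2 : (N - m) ^ 2 ≤ 9 * b ^ 2 * max m 1 := by
    rw [← sq_abs]
    calc |N - m| ^ 2 ≤ (3 * b * √(max m 1)) ^ 2 := by gcongr
      _ = _ := by rw [mul_pow, Real.sq_sqrt (by linarith)]; ring
  have hsq : √(max m 1) ≤ max m 1 := by
    rw [Real.sqrt_le_left (by linarith)]; nlinarith
  obtain ⟨hlo, hup⟩ := abs_le.1 hdev
  have hR : 1 ≤ b ^ 3 := one_le_pow₀ (by linarith)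
  have hup' : N / m ≤ b ^ 3 := by
    rw [div_le_iff₀ hm0]
    have h1 : 3 * b * √(max m 1) ≤ 3 * b * (b * m) := by gcongr; exact hsq.trans hmax
    have h2 : 1 + 3 * b ^ 2 ≤ b ^ 3 := by nlinarith
    nlinarith [mul_le_mul_of_nonneg_right h2 hm0.le]
  have hlo' : (b ^ 3)⁻¹ ≤ N / m := by
    rw [inv_eq_one_div, div_le_div_iff₀ (by positivity) hm0, one_mul]
    -- for `m ≤ 36 b ^ 2 ≤ b ^ 3` use `N ≥ 1`; for larger `m` the deviation is at most `m / 2`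
    rcases le_total m (36 * b ^ 2) with h | h
    · nlinarith [sq_nonneg b]
    · have hm1 : 1 ≤ m := by nlinarith
      rw [max_eq_left hm1] at hlo
      have h3 : 6 * b ≤ √m := Real.le_sqrt_of_sq_le (by nlinarith)
      have h4 : 3 * b * √m ≤ m / 2 := by
        nlinarith [Real.mul_self_sqrt hm0.le, Real.sqrt_nonneg m]
      have h5 : m ≤ 2 * N := by linarith
      have h6 : (2 : ℝ) ≤ b ^ 3 := by nlinarith [sq_nonneg b]
      nlinarith
  have hphi := phi_le_of_ratio (s := s) hR hlo' hup'
  have hpow : (b ^ 3) ^ |s - 2| = b ^ (3 * |s - 2|) := by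
    rw [← Real.rpow_natCast, ← Real.rpow_mul hb0.le]; norm_num
  rw [hpow] at hphi
  have hmsq : m * (N / m - 1) ^ 2 ≤ 9 * b ^ 3 := by
    have : m * (N / m - 1) ^ 2 = (N - m) ^ 2 / m := by field_simp
    rw [this, div_le_iff₀ hm0]
    calc (N - m) ^ 2 ≤ 9 * b ^ 2 * (b * m) := hdev2.trans (by gcongr)
      _ = _ := by ring
  have hbp : 0 < b ^ (3 * |s - 2|) := Real.rpow_pos_of_pos hb0 _
  calc m * phi s (N / m) ≤ m * (b ^ (3 * |s - 2|) / 2 * (N / m - 1) ^ 2) := by gcongr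
    _ = b ^ (3 * |s - 2|) / 2 * (m * (N / m - 1) ^ 2) := by ring
    _ ≤ b ^ (3 * |s - 2|) / 2 * (9 * b ^ 3) := by gcongr
    _ ≤ b ^ (3 * |s - 2|) * b ^ 5 := by
        have : 9 * b ^ 3 ≤ 2 * b ^ 5 := by
          have : 9 ≤ 2 * b ^ 2 := by nlinarith
          nlinarith [pow_pos hb0 3]
        nlinarith
    _ = b ^ (5 + 3 * |s - 2|) := by
        rw [← Real.rpow_natCast, ← Real.rpow_add hb0]; congr 1; push_cast; ring

/-! ### Exponential bounds for counts -/

/-- The number of observations in `A`, as a real number. -/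
noncomputable def count {n : ℕ} (A : Set ℝ) (x : Fin n → ℝ) : ℝ :=
  ∑ i, A.indicator (fun _ => (1 : ℝ)) (x i)

section Count

variable {n : ℕ} {A B : Set ℝ} {x : Fin n → ℝ}

lemma count_mono (h : A ⊆ B) : count A x ≤ count B x :=
  Finset.sum_le_sum fun i _ =>
    indicator_le_indicator_of_subset h (fun _ => zero_le_one) (x i)

lemma count_compl : count Aᶜ x = n - count A x := by
  have : ∀ y : ℝ, Aᶜ.indicator (fun _ => (1 : ℝ)) y = 1 - A.indicator (fun _ => (1 : ℝ)) y := by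
    intro y
    by_cases hy : y ∈ A <;> simp [hy]
  simp [count, this, Finset.sum_sub_distrib]

lemma one_le_count {i : Fin n} (hi : x i ∈ A) : 1 ≤ count A x := by
  have := Finset.single_le_sum (f := fun i => A.indicator (fun _ => (1 : ℝ)) (x i))
    (fun j _ => indicator_nonneg (fun _ _ => zero_le_one) (x j)) (Finset.mem_univ i)
  simpa [count, hi] using this

lemma exists_mem_of_count_pos (h : 0 < count A x) : ∃ i, x i ∈ A := by
  by_contra! hne
  simp [count, hne] at h

lemma empCdf_eq_count (x : Fin n → ℝ) (y : ℝ) : empCdf x y = count (Iic y) x / n := by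
  simp [empCdf, count, indicator_apply]

end Count

lemma integral_exp_indicator_le (ν : Measure ℝ) [IsProbabilityMeasure ν] {A : Set ℝ}
    (hA : MeasurableSet A) {θ : ℝ} (hθ : |θ| ≤ 1) :
    ∫ y, Real.exp (θ * (A.indicator (fun _ => (1 : ℝ)) y - ν.real A)) ∂ν
      ≤ Real.exp (ν.real A * θ ^ 2) := by
  have hpt : ∀ y, Real.exp (θ * (A.indicator (fun _ => (1 : ℝ)) y - ν.real A))
      = Real.exp (-(θ * ν.real A)) *
        (1 + (Real.exp θ - 1) * A.indicator (fun _ => (1 : ℝ)) y) := by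
    intro y
    by_cases hy : y ∈ A
    · simp only [indicator_of_mem hy]
      rw [mul_one, add_sub_cancel, ← Real.exp_add]; congr 1; ring
    · simp only [indicator_of_notMem hy]; simp
  have hint : Integrable (A.indicator (fun _ => (1 : ℝ))) ν := (integrable_const 1).indicator hA
  simp only [hpt]
  rw [integral_const_mul, integral_add (integrable_const _) (hint.const_mul _),
    integral_const_mul, integral_indicator_const _ hA]
  simp only [integral_const, probReal_univ, smul_eq_mul, mul_one]
  have hp : 0 ≤ ν.real A := measureReal_nonneg
  have h1 : 1 + (Real.exp θ - 1) * ν.real A ≤ Real.exp ((Real.exp θ - 1) * ν.real A) := by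
    linarith [Real.add_one_le_exp ((Real.exp θ - 1) * ν.real A)]
  have h2 := (abs_le.1 (Real.abs_exp_sub_one_sub_id_le hθ)).2
  calc _ ≤ Real.exp (-(θ * ν.real A)) * Real.exp ((Real.exp θ - 1) * ν.real A) := by gcongr
    _ = Real.exp ((Real.exp θ - 1 - θ) * ν.real A) := by rw [← Real.exp_add]; congr 1; ring
    _ ≤ _ := by
      refine Real.exp_le_exp.2 ?_
      rw [mul_comm]
      gcongr

lemma count_chernoff (ν : Measure ℝ) [IsProbabilityMeasure ν] {A : Set ℝ}
    (hA : MeasurableSet A) (n : ℕ) {θ : ℝ} (hθ : |θ| ≤ 1) (a : ℝ) :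
    (Measure.pi fun _ : Fin n => ν).real {x | a ≤ θ * (count A x - n * ν.real A)}
      ≤ Real.exp (n * ν.real A * θ ^ 2 - a) := by
  set g : ℝ → ℝ := fun y => Real.exp (θ * (A.indicator (fun _ => (1 : ℝ)) y - ν.real A)) with hg
  have hmeas : Measurable g := by
    have : Measurable (A.indicator (fun _ : ℝ => (1 : ℝ))) := measurable_const.indicator hA
    fun_prop
  have hgint : Integrable g ν := by
    refine Integrable.of_bound hmeas.aestronglyMeasurable (Real.exp 1) (ae_of_all _ fun y => ?_)
    rw [Real.norm_eq_abs, abs_of_pos (Real.exp_pos _)]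
    refine Real.exp_le_exp.2 ((le_abs_self _).trans ?_)
    rw [abs_mul]
    refine mul_le_one₀ hθ (abs_nonneg _) (abs_le.2 ?_)
    have h0 : 0 ≤ ν.real A := measureReal_nonneg
    have h1 : ν.real A ≤ 1 := measureReal_le_one
    by_cases hy : y ∈ A
    · rw [indicator_of_mem hy]; constructor <;> linarith
    · rw [indicator_of_notMem hy]; constructor <;> linarith
  have hprod : ∀ x : Fin n → ℝ, Real.exp (θ * (count A x - n * ν.real A)) = ∏ i, g (x i) := by
    intro x
    simp only [hg]
    rw [← Real.exp_sum, ← Finset.mul_sum, Finset.sum_sub_distrib]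
    simp [count]
  have hint : Integrable (fun x : Fin n → ℝ => ∏ i, g (x i)) (Measure.pi fun _ => ν) :=
    Integrable.fintype_prod (f := fun _ => g) fun _ => hgint
  have hmk := mul_meas_ge_le_integral_of_nonneg (μ := Measure.pi fun _ : Fin n => ν)
    (f := fun x => ∏ i, g (x i)) (ae_of_all _ fun x => Finset.prod_nonneg fun i _ =>
      (Real.exp_pos _).le) hint (Real.exp a)
  rw [integral_fintype_prod_eq_pow, Fintype.card_fin] at hmk
  have hset : {x : Fin n → ℝ | a ≤ θ * (count A x - n * ν.real A)}
      = {x | Real.exp a ≤ ∏ i, g (x i)} := by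
    ext x
    simp only [mem_ofPred_eq, ← hprod, Real.exp_le_exp]
  rw [hset]
  have hpow : (∫ y, g y ∂ν) ^ n ≤ Real.exp (n * ν.real A * θ ^ 2) := by
    calc (∫ y, g y ∂ν) ^ n ≤ (Real.exp (ν.real A * θ ^ 2)) ^ n := by
          refine pow_le_pow_left₀ (integral_nonneg fun y => (Real.exp_pos _).le) ?_ n
          exact integral_exp_indicator_le ν hA hθ
      _ = _ := by rw [← Real.exp_nat_mul]; congr 1; ring
  rw [Real.exp_sub, le_div_iff₀ (Real.exp_pos _), mul_comm]
  exact hmk.trans hpow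

/-- A count deviates from its mean `m` by more than `b √max(m, 1)` with exponentially small
probability. -/
lemma count_deviation (ν : Measure ℝ) [IsProbabilityMeasure ν] {A : Set ℝ}
    (hA : MeasurableSet A) (n : ℕ) (b : ℝ) {m : ℝ} (hm : n * ν.real A = m) :
    (Measure.pi fun _ : Fin n => ν) {x | b * √(max m 1) ≤ |count A x - m|}
      ≤ ENNReal.ofReal (2 * Real.exp (1 - b)) := by
  subst hm
  set m := n * ν.real A with hmdef
  -- the Chernoff parameter `1 / r` makes the quadratic term at most `1`
  set r := √(max m 1) with hr
  have hr1 : 1 ≤ r := Real.one_le_sqrt.2 (le_max_right _ _)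
  have hr0 : 0 < r := by linarith
  have hmr : m ≤ r ^ 2 := by rw [hr, Real.sq_sqrt (by positivity)]; exact le_max_left _ _
  have habs : |r⁻¹| ≤ 1 := by rw [abs_of_pos (inv_pos.2 hr0)]; exact inv_le_one_of_one_le₀ hr1
  have hexp : Real.exp (m * r⁻¹ ^ 2 - b) ≤ Real.exp (1 - b) := by
    refine Real.exp_le_exp.2 (sub_le_sub_right ?_ _)
    rw [inv_pow, ← div_eq_mul_inv, div_le_one (by positivity)]
    exact hmr
  have h1 := (count_chernoff ν hA n habs b).trans hexp
  have h2 := count_chernoff ν hA n (θ := -r⁻¹) (by rwa [abs_neg]) b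
  rw [neg_sq] at h2
  replace h2 := h2.trans hexp
  have hsub : {x : Fin n → ℝ | b * r ≤ |count A x - m|} ⊆
      {x | b ≤ r⁻¹ * (count A x - m)} ∪ {x | b ≤ -r⁻¹ * (count A x - m)} := by
    intro x hx
    rcases le_abs'.1 (show b * r ≤ |count A x - m| from hx) with h | h
    · right
      show b ≤ -r⁻¹ * (count A x - m)
      rw [neg_mul, ← mul_neg, ← div_eq_inv_mul, le_div_iff₀ hr0]
      linarith
    · left
      show b ≤ r⁻¹ * (count A x - m)
      rw [← div_eq_inv_mul, le_div_iff₀ hr0]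
      exact h
  refine (measure_mono hsub).trans ?_
  rw [← ofReal_measureReal]
  refine ENNReal.ofReal_le_ofReal ?_
  refine (measureReal_union_le _ _).trans ?_
  linarith

lemma pi_exists_mem_le (ν : Measure ℝ) [IsProbabilityMeasure ν] (A : Set ℝ)
    (n : ℕ) : (Measure.pi fun _ : Fin n => ν) {x | ∃ i, x i ∈ A} ≤ n * ν A := by
  have : {x : Fin n → ℝ | ∃ i, x i ∈ A} ⊆ {x | ∃ i, x i ∈ toMeasurable ν A} := by
    rintro x ⟨i, hi⟩
    exact ⟨i, subset_toMeasurable _ _ hi⟩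
  refine (measure_mono this).trans ?_
  rw [ofPred_exists]
  refine (measure_iUnion_fintype_le _ _).trans ?_
  have h1 : ∀ i : Fin n, (Measure.pi fun _ : Fin n => ν) {x | x i ∈ toMeasurable ν A} = ν A := by
    intro i
    rw [← measure_toMeasurable A]
    exact (measurePreserving_eval (fun _ : Fin n => ν) i).measure_preimage
      (measurableSet_toMeasurable _ _).nullMeasurableSet
  simp [h1]

/-! ### The statistic under the null -/

/-- On the event that the counts in `{F₀ < k / n}` are close to their means for all `k` and that no
observation is too extreme, the divergence is small at every point of the range. -/
lemma K_le_of_good (P₀ : Measure ℝ) [IsProbabilityMeasure P₀] (s : ℝ) {n : ℕ} {b : ℝ}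
    (hb : 38 ≤ b) {x : Fin n → ℝ}
    (h1 : ∀ k ∈ Finset.range (n + 1),
      |count {y | cdf P₀ y < k / n} x - k| < b * √(max (k : ℝ) 1))
    (h2 : ∀ k ∈ Finset.range (n + 1),
      |count {y | cdf P₀ y < k / n} x - k| < b * √(max ((n : ℝ) - k) 1))
    (h3 : ∀ i, 1 / (n * b) ≤ cdf P₀ (x i)) (h4 : ∀ i, cdf P₀ (x i) ≤ 1 - 1 / (n * b))
    {y : ℝ} (hy : y ∈ Ico (⨅ i, x i) (⨆ i, x i)) :
    K s (empCdf x y) (cdf P₀ y) ≤ 2 * b ^ (5 + 3 * |s - 2|) / n := by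
  have hb0 : 0 < b := by linarith
  have hne : Nonempty (Fin n) := by
    by_contra hne
    rw [not_nonempty_iff] at hne
    rw [Real.iInf_of_isEmpty, Real.iSup_of_isEmpty] at hy
    exact absurd hy.2 (not_lt.2 hy.1)
  have hn : 0 < n := Fin.pos_iff_nonempty.2 hne
  have hn0 : (0 : ℝ) < n := Nat.cast_pos.2 hn
  obtain ⟨i, hi⟩ := exists_eq_ciInf_of_finite (f := x)
  obtain ⟨j, hj⟩ := exists_eq_ciSup_of_finite (f := x)
  have hiy : x i ≤ y := hi ▸ hy.1
  have hjy : y < x j := hj ▸ hy.2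
  set v := cdf P₀ y with hv
  have hv1 : 1 / (n * b) ≤ v := (h3 i).trans (monotone_cdf P₀ hiy)
  have hv2 : v ≤ 1 - 1 / (n * b) := (monotone_cdf P₀ hjy.le).trans (h4 j)
  have hnb : 0 < 1 / (n * b) := by positivity
  have hv0 : 0 < v := by linarith
  have hvlt : v < 1 := by linarith
  set N := count (Iic y) x with hN
  have hN1 : 1 ≤ N := one_le_count (i := i) hiy
  have hN2 : 1 ≤ n - N := by
    rw [hN, ← count_compl]
    exact one_le_count (i := j) (by simpa using hjy)
  set m := n * v with hm
  have hm0 : 0 < m := by positivity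
  set k := ⌊m⌋₊ with hk
  have hkm : (k : ℝ) ≤ m := Nat.floor_le hm0.le
  have hmk : m < k + 1 := Nat.lt_floor_add_one m
  have hmn : m < n := by rw [hm]; nlinarith
  have hkn : k + 1 ≤ n := by
    have : (k : ℝ) < n := hkm.trans_lt hmn
    exact_mod_cast this
  have hkn' : (k : ℝ) + 1 ≤ n := by exact_mod_cast hkn
  -- the inequality `F₀ < k / n` is strict, so flat pieces of `F₀` cause no trouble on either side
  have hlow : count {z | cdf P₀ z < k / n} x ≤ N := by
    refine count_mono fun z hz => ?_
    have hz : cdf P₀ z < k / n := hz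
    have : (k : ℝ) / n ≤ v := by rw [div_le_iff₀ hn0, mul_comm]; exact hkm
    by_contra hlt
    exact absurd (monotone_cdf P₀ (not_le.1 hlt).le) (not_le.2 (hz.trans_le this))
  have hupp : N ≤ count {z | cdf P₀ z < (k + 1 : ℕ) / n} x := by
    refine count_mono fun z hz => ?_
    have : v < (k + 1 : ℕ) / n := by
      rw [lt_div_iff₀ hn0, mul_comm]; push_cast; exact hmk
    exact (monotone_cdf P₀ hz).trans_lt this
  have hk1 : k ∈ Finset.range (n + 1) := Finset.mem_range.2 (by omega)
  have hk2 : k + 1 ∈ Finset.range (n + 1) := Finset.mem_range.2 (by omega)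
  -- replacing the mean at a grid point by the mean `M` at `y` costs a factor `√2 + 1 < 3`
  have hsqrt : ∀ M z : ℝ, z ≤ M + 1 → b * √(max z 1) + 1 ≤ 3 * b * √(max M 1) := by
    intro M z hz
    have hM1 : 1 ≤ √(max M 1) := Real.one_le_sqrt.2 (le_max_right _ _)
    have : √(max z 1) ≤ 2 * √(max M 1) := by
      rw [Real.sqrt_le_left (by positivity), mul_pow, Real.sq_sqrt (by positivity)]
      refine max_le ?_ ?_ <;> linarith [le_max_left M 1, le_max_right M 1]
    nlinarith
  have a1 := abs_lt.1 (h1 k hk1)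
  have a2 := abs_lt.1 (h1 (k + 1) hk2)
  have a3 := abs_lt.1 (h2 k hk1)
  have a4 := abs_lt.1 (h2 (k + 1) hk2)
  push_cast at a2 a4 hupp
  have hdev : |N - m| ≤ 3 * b * √(max m 1) := by
    have e1 := hsqrt m k (by linarith)
    have e2 := hsqrt m (k + 1) (by linarith)
    rw [abs_le]; constructor <;> linarith
  have hdev' : |(n - N) - n * (1 - v)| ≤ 3 * b * √(max (n * (1 - v)) 1) := by
    have e1 := hsqrt (n * (1 - v)) (n - k) (by linarith)
    have e2 := hsqrt (n * (1 - v)) (n - (k + 1)) (by linarith)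
    rw [abs_le]; constructor <;> linarith
  have hnbv : ∀ z : ℝ, 1 / (n * b) ≤ z → b⁻¹ ≤ n * z := by
    intro z hz
    calc b⁻¹ = n * (1 / (n * b)) := by field_simp
      _ ≤ n * z := by gcongr
  have r1 := mul_phi_ratio_le s hb hN1 (hnbv v hv1) hdev
  have r2 := mul_phi_ratio_le s hb hN2 (hnbv (1 - v) (by linarith)) hdev'
  have hu : empCdf x y = N / n := empCdf_eq_count x y
  have hv1' : 0 < 1 - v := by linarith
  rw [K, hu, show N / n / v = N / m by rw [hm, div_div],
    show (1 - N / n) / (1 - v) = (n - N) / (n * (1 - v)) by field_simp, le_div_iff₀ hn0]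
  calc _ = m * phi s (N / m) + n * (1 - v) * phi s ((n - N) / (n * (1 - v))) := by ring
    _ ≤ _ := by linarith

lemma null_statistic_bound (P₀ : Measure ℝ) [IsProbabilityMeasure P₀] [NullSingletonClass P₀]
    (s : ℝ) {n : ℕ} (hn : 0 < n) {b : ℝ} (hb : 38 ≤ b) :
    nullLaw P₀ n {x | ((2 * b ^ (5 + 3 * |s - 2|) / n : ℝ) : EReal) < S P₀ s x}
      ≤ ENNReal.ofReal (4 * (n + 1) * Real.exp (1 - b) + 2 / b) := by
  have hb0 : 0 < b := by linarith
  have hn0 : (0 : ℝ) < n := Nat.cast_pos.2 hn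
  have hn1 : (1 : ℝ) ≤ n := Nat.one_le_cast.2 hn
  set e := ENNReal.ofReal (2 * Real.exp (1 - b)) with he
  let A : ℕ → Set ℝ := fun k => {y | cdf P₀ y < k / n}
  have hA : ∀ k, MeasurableSet (A k) := fun k =>
    measurableSet_lt (monotone_cdf P₀).measurable measurable_const
  have hPA : ∀ k ∈ Finset.range (n + 1), n * P₀.real (A k) = k := by
    intro k hk
    have hkn : (k : ℝ) ≤ n := by exact_mod_cast Nat.lt_succ_iff.1 (Finset.mem_range.1 hk)
    have : P₀.real (A k) = k / n := by
      rw [measureReal_def, measure_cdf_lt (by rw [div_le_one hn0]; exact hkn),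
        ENNReal.toReal_ofReal (by positivity)]
    rw [this, mul_div_cancel₀ _ hn0.ne']
  have hw : 1 / (n * b) ≤ 1 := by
    rw [div_le_one (by positivity)]; nlinarith
  let B1 : Set (Fin n → ℝ) := ⋃ k ∈ Finset.range (n + 1),
    {x | b * √(max (k : ℝ) 1) ≤ |count (A k) x - k|}
  let B2 : Set (Fin n → ℝ) := ⋃ k ∈ Finset.range (n + 1),
    {x | b * √(max ((n : ℝ) - k) 1) ≤ |count (A k)ᶜ x - (n - k)|}
  let B3 : Set (Fin n → ℝ) := {x | ∃ i, x i ∈ {y | cdf P₀ y < 1 / (n * b)}}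
  let B4 : Set (Fin n → ℝ) := {x | ∃ i, x i ∈ {y | 1 - 1 / (n * b) < cdf P₀ y}}
  have hsub : {x : Fin n → ℝ | ((2 * b ^ (5 + 3 * |s - 2|) / n : ℝ) : EReal) < S P₀ s x}
      ⊆ (B1 ∪ B2) ∪ (B3 ∪ B4) := by
    intro x hx
    by_contra hnot
    simp only [mem_union, not_or, B1, B2, B3, B4, mem_iUnion, mem_ofPred_eq, not_exists,
      not_le, not_lt] at hnot
    obtain ⟨⟨g1, g2⟩, g3, g4⟩ := hnot
    refine absurd (show _ < S P₀ s x from hx) (not_lt.2 ?_)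
    refine iSup₂_le fun y hy => EReal.coe_le_coe_iff.2 ?_
    refine K_le_of_good P₀ s hb g1 (fun k hk => ?_) g3 g4 hy
    have := g2 k hk
    rwa [count_compl, ← abs_neg, show -((n : ℝ) - count (A k) x - (n - k)) = count (A k) x - k by
      ring] at this
  have m1 : nullLaw P₀ n B1 ≤ (n + 1 : ℕ) * e := by
    refine (measure_biUnion_finset_le _ _).trans ?_
    refine (Finset.sum_le_card_nsmul _ _ e fun k hk =>
      count_deviation P₀ (hA k) n b (hPA k hk)).trans ?_
    rw [Finset.card_range, nsmul_eq_mul]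
  have m2 : nullLaw P₀ n B2 ≤ (n + 1 : ℕ) * e := by
    refine (measure_biUnion_finset_le _ _).trans ?_
    refine (Finset.sum_le_card_nsmul _ _ e fun k hk =>
      count_deviation P₀ (hA k).compl n b ?_).trans ?_
    · rw [measureReal_compl (hA k), probReal_univ, mul_sub, mul_one, hPA k hk]
    · rw [Finset.card_range, nsmul_eq_mul]
  have hnw : (n : ℝ≥0∞) * ENNReal.ofReal (1 / (n * b)) = ENNReal.ofReal (1 / b) := by
    rw [← ENNReal.ofReal_natCast, ← ENNReal.ofReal_mul hn0.le]; congr 1; field_simp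
  have m3 : nullLaw P₀ n B3 ≤ ENNReal.ofReal (1 / b) := by
    refine (pi_exists_mem_le P₀ _ n).trans ?_
    rw [measure_cdf_lt hw, hnw]
  have m4 : nullLaw P₀ n B4 ≤ ENNReal.ofReal (1 / b) := by
    refine (pi_exists_mem_le P₀ _ n).trans ?_
    rw [measure_lt_cdf hw, hnw]
  refine (measure_mono hsub).trans ((measure_union_le _ _).trans ?_)
  refine (add_le_add ((measure_union_le _ _).trans (add_le_add m1 m2))
    ((measure_union_le _ _).trans (add_le_add m3 m4))).trans (le_of_eq ?_)
  rw [he, ← ENNReal.ofReal_natCast, ← ENNReal.ofReal_mul (by positivity),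
    ← ENNReal.ofReal_add (by positivity) (by positivity),
    ← ENNReal.ofReal_add (by positivity) (by positivity),
    ← ENNReal.ofReal_add (by positivity) (by positivity)]
  congr 1
  push_cast
  ring

/-! ### Likelihood ratios of product measures -/

lemma pi_withDensity_eq {P : Measure ℝ} [IsProbabilityMeasure P] {q : ℝ → ℝ≥0∞}
    (hq : Measurable q) [IsFiniteMeasure (P.withDensity q)] (n : ℕ) :
    (Measure.pi fun _ : Fin n => P.withDensity q)
      = (Measure.pi fun _ : Fin n => P).withDensity fun x => ∏ i, q (x i) := by
  refine Measure.pi_eq fun s hs => ?_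
  have hpi : MeasurableSet (univ.pi s) := MeasurableSet.univ_pi hs
  have hind : ∀ i, Measurable ((s i).indicator q) := fun i => hq.indicator (hs i)
  rw [withDensity_apply _ hpi, ← lintegral_indicator hpi]
  have hpt : ∀ x : Fin n → ℝ, (univ.pi s).indicator (fun x => ∏ i, q (x i)) x
      = ∏ i, (s i).indicator q (x i) := by
    intro x
    by_cases hx : x ∈ univ.pi s
    · rw [indicator_of_mem hx]
      exact Finset.prod_congr rfl fun i _ => (indicator_of_mem (hx i (mem_univ i)) q).symm
    · rw [indicator_of_notMem hx]
      obtain ⟨i, hi⟩ : ∃ i, x i ∉ s i := by simpa [Set.mem_pi] using hx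
      exact (Finset.prod_eq_zero (Finset.mem_univ i) (indicator_of_notMem hi q)).symm
  simp only [hpt]
  have hindep := iIndepFun_pi (μ := fun _ : Fin n => P) (X := fun i => (s i).indicator q)
    fun i => (hind i).aemeasurable
  rw [lintegral_prod_eq_prod_lintegral_of_indepFun Finset.univ _ hindep
    fun i => (hind i).comp (measurable_pi_apply i)]
  refine Finset.prod_congr rfl fun i _ => ?_
  rw [withDensity_apply _ (hs i), ← lintegral_indicator (hs i)]
  exact (measurePreserving_eval (fun _ : Fin n => P) i).lintegral_comp (hind i)

/-- The mixture `(1 - ε) P + ε μ`. -/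
noncomputable def mixture (P μ : Measure ℝ) (ε : ℝ) : Measure ℝ :=
  ENNReal.ofReal (1 - ε) • P + ENNReal.ofReal ε • μ

lemma isProbabilityMeasure_mixture (P μ : Measure ℝ) [IsProbabilityMeasure P]
    [IsProbabilityMeasure μ] {ε : ℝ} (h0 : 0 ≤ ε) (h1 : ε ≤ 1) :
    IsProbabilityMeasure (mixture P μ ε) := by
  refine ⟨?_⟩
  simp only [mixture, Measure.coe_add, Measure.coe_smul, Pi.add_apply, Pi.smul_apply, measure_univ,
    smul_eq_mul, mul_one]
  rw [← ENNReal.ofReal_add (by linarith) h0]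
  simp

lemma mixture_eq_withDensity (P : Measure ℝ) {f : ℝ → ℝ≥0∞} (hf : Measurable f) (ε : ℝ) :
    mixture P (P.withDensity f) ε
      = P.withDensity fun y => ENNReal.ofReal (1 - ε) + ENNReal.ofReal ε * f y := by
  rw [mixture, show (fun y => ENNReal.ofReal (1 - ε) + ENNReal.ofReal ε * f y)
    = (fun _ => ENNReal.ofReal (1 - ε)) + ENNReal.ofReal ε • f from rfl,
    withDensity_add_left measurable_const, withDensity_const, withDensity_smul _ hf]

lemma mixture_real_apply (P μ : Measure ℝ) [IsProbabilityMeasure P]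
    [IsProbabilityMeasure μ] {ε : ℝ} (h0 : 0 ≤ ε) (h1 : ε ≤ 1) (A : Set ℝ) :
    (mixture P μ ε).real A = (1 - ε) * P.real A + ε * μ.real A := by
  simp only [mixture, measureReal_def, Measure.coe_add, Measure.coe_smul, Pi.add_apply,
    Pi.smul_apply, smul_eq_mul]
  rw [ENNReal.toReal_add (by finiteness) (by finiteness), ENNReal.toReal_mul, ENNReal.toReal_mul,
    ENNReal.toReal_ofReal (by linarith), ENNReal.toReal_ofReal h0]

lemma altLaw_eq (P₀ : Measure ℝ) (μ : ℕ → Measure ℝ) (β : ℝ) (n : ℕ) :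
    altLaw P₀ μ β n = Measure.pi fun _ : Fin n => mixture P₀ (μ n) ((n : ℝ) ^ (-β)) := rfl

lemma rpow_neg_nonneg_le_one {β : ℝ} (hβ : 0 < β) (n : ℕ) :
    0 ≤ (n : ℝ) ^ (-β) ∧ (n : ℝ) ^ (-β) ≤ 1 := by
  refine ⟨by positivity, ?_⟩
  rcases Nat.eq_zero_or_pos n with rfl | hn
  · rw [Nat.cast_zero, Real.zero_rpow (by linarith)]; exact zero_le_one
  · exact Real.rpow_le_one_of_one_le_of_nonpos (Nat.one_le_cast.2 hn) (by linarith)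

/-- **Neyman–Pearson**: the likelihood ratio test with critical value `1` minimizes the sum of the
error probabilities. -/
lemma likelihood_ratio_optimal {Ω : Type*} [MeasurableSpace Ω] {P Q : Measure Ω}
    [IsProbabilityMeasure P] [IsProbabilityMeasure Q] (hQP : Q ≪ P) (R : Set Ω) :
    P {x | 1 < Q.rnDeriv P x} + Q {x | 1 < Q.rnDeriv P x}ᶜ ≤ P R + Q Rᶜ := by
  set L := Q.rnDeriv P with hL
  have hLm : Measurable L := Measure.measurable_rnDeriv Q P
  have hsum : ∀ A : Set Ω, MeasurableSet A →
      P A + Q Aᶜ = ∫⁻ x, (A.indicator 1 x + Aᶜ.indicator L x) ∂P := by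
    intro A hA
    rw [lintegral_add_left (measurable_one.indicator hA), lintegral_indicator_one hA,
      lintegral_indicator hA.compl, Measure.setLIntegral_rnDeriv hQP]
  have hR' := measurableSet_toMeasurable P R
  have hR0 : MeasurableSet {x | 1 < L x} := measurableSet_lt measurable_const hLm
  -- `R` need not be measurable; a measurable hull under `P` only decreases the type 2 error
  calc _ ≤ P (toMeasurable P R) + Q (toMeasurable P R)ᶜ := by
        rw [hsum _ hR0, hsum _ hR']
        refine lintegral_mono fun x => ?_
        by_cases h1 : x ∈ {x | 1 < L x} <;> by_cases h2 : x ∈ toMeasurable P R <;>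
          simp only [mem_compl_iff, h1, h2, indicator_of_mem, indicator_of_notMem, not_true,
            not_false_iff, Pi.one_apply, add_zero, zero_add, le_refl]
        · exact le_of_lt h1
        · exact not_lt.1 h1
    _ ≤ P R + Q Rᶜ := by
        rw [measure_toMeasurable]
        gcongr
        exact subset_toMeasurable P R

lemma LRDetectable.of_completelySeparates {P₀ : Measure ℝ} [IsProbabilityMeasure P₀]
    {μ : ℕ → Measure ℝ} [∀ n, IsProbabilityMeasure (μ n)] {f : ℕ → ℝ → ℝ≥0∞}
    (hf : ∀ n, Measurable (f n)) (hμ : ∀ n, μ n = P₀.withDensity (f n)) {β : ℝ} (hβ : 0 < β)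
    {R : (n : ℕ) → Set (Fin n → ℝ)} (hR : CompletelySeparates P₀ μ β R) :
    LRDetectable P₀ μ β := by
  refine ⟨fun _ => 1, ?_⟩
  refine tendsto_of_tendsto_of_tendsto_of_le_of_le tendsto_const_nhds hR
    (fun _ => zero_le) fun n => ?_
  obtain ⟨h0, h1⟩ := rpow_neg_nonneg_le_one hβ n
  have hQ := isProbabilityMeasure_mixture P₀ (μ n) h0 h1
  have hac : altLaw P₀ μ β n ≪ nullLaw P₀ n := by
    have hq := mixture_eq_withDensity P₀ (hf n) ((n : ℝ) ^ (-β))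
    rw [← hμ n] at hq
    rw [hq] at hQ
    rw [altLaw_eq, nullLaw, hq, pi_withDensity_eq ((hf n).const_mul _ |>.const_add _)]
    exact withDensity_absolutelyContinuous _ _
  have i1 : IsProbabilityMeasure (nullLaw P₀ n) := by unfold nullLaw; infer_instance
  have i2 : IsProbabilityMeasure (altLaw P₀ μ β n) := by rw [altLaw_eq]; infer_instance
  exact likelihood_ratio_optimal hac (R n)

/-! ### The statistic under the alternative -/

lemma K_symm (s u v : ℝ) : K s (1 - u) (1 - v) = K s u v := by
  simp only [K, sub_sub_cancel]; ring

lemma K_lower {s c u v ρ : ℝ} (hv : 0 < v) (hv1 : v < 1) (hu1 : u < 1) (hρ : 0 ≤ ρ)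
    (hc : ∀ ρ x : ℝ, 0 ≤ ρ → 1 + ρ ≤ x → c * min ρ (ρ ^ 2) ≤ phi s x)
    (hu : v * (1 + ρ) ≤ u) : v * (c * min ρ (ρ ^ 2)) ≤ K s u v := by
  have h1 : c * min ρ (ρ ^ 2) ≤ phi s (u / v) :=
    hc ρ _ hρ (by rw [le_div_iff₀ hv, mul_comm]; exact hu)
  have h2 : 0 ≤ phi s ((1 - u) / (1 - v)) :=
    phi_nonneg s (div_pos (by linarith) (by linarith))
  have h3 : 0 ≤ (1 - v) * phi s ((1 - u) / (1 - v)) := mul_nonneg (by linarith) h2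
  have := mul_le_mul_of_nonneg_left h1 hv.le
  rw [K]; linarith

/-- `A` is a left or a right half-line of probability `v` under `P₀`. -/
def IsTail (P₀ : Measure ℝ) (v : ℝ) (A : Set ℝ) : Prop :=
  ∃ z, (A = Iic z ∧ cdf P₀ z = v) ∨ (A = Ioi z ∧ cdf P₀ z = 1 - v)

lemma IsTail.measurableSet {P₀ : Measure ℝ} {v : ℝ} {A : Set ℝ} (h : IsTail P₀ v A) :
    MeasurableSet A := by
  obtain ⟨z, ⟨rfl, -⟩ | ⟨rfl, -⟩⟩ := h
  exacts [measurableSet_Iic, measurableSet_Ioi]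

lemma IsTail.real_eq {P₀ : Measure ℝ} [IsProbabilityMeasure P₀] {v : ℝ} {A : Set ℝ}
    (h : IsTail P₀ v A) : P₀.real A = v := by
  obtain ⟨z, ⟨rfl, h⟩ | ⟨rfl, h⟩⟩ := h
  · rw [← cdf_eq_real, h]
  · rw [← compl_Iic, measureReal_compl measurableSet_Iic, ← cdf_eq_real, h, probReal_univ]; ring

/-- The count has to lie strictly between `0` and `n`, so that the endpoint of the half-line is in
the range of the supremum. -/
lemma IsTail.K_le_S {P₀ : Measure ℝ} {v : ℝ} {A : Set ℝ}
    (h : IsTail P₀ v A) (s : ℝ) {n : ℕ} {x : Fin n → ℝ} (h0 : 0 < count A x)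
    (h1 : count A x < n) : ((K s (count A x / n) v : ℝ) : EReal) ≤ S P₀ s x := by
  have hn0 : (n : ℝ) ≠ 0 := (h0.trans h1).ne'
  have hsup : ∀ z, 0 < count (Iic z) x → count (Iic z) x < n →
      ((K s (count (Iic z) x / n) (cdf P₀ z) : ℝ) : EReal) ≤ S P₀ s x := by
    intro z hz0 hz1
    obtain ⟨i, hi⟩ := exists_mem_of_count_pos hz0
    obtain ⟨j, hj⟩ := exists_mem_of_count_pos (A := (Iic z)ᶜ) (x := x)
      (by rw [count_compl]; linarith)
    rw [← empCdf_eq_count]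
    exact le_iSup₂_of_le z ⟨(ciInf_le (finite_range x).bddBelow i).trans hi,
      lt_of_lt_of_le (by simpa using hj) (le_ciSup (finite_range x).bddAbove j)⟩ le_rfl
  obtain ⟨z, ⟨rfl, h⟩ | ⟨rfl, h⟩⟩ := h
  · rw [← h]; exact hsup z h0 h1
  · rw [← compl_Iic, count_compl] at h0 h1 ⊢
    have := hsup z (by linarith) (by linarith)
    rwa [h, ← K_symm, sub_sub_cancel, show 1 - count (Iic z) x / n = (n - count (Iic z) x) / n by
      field_simp] at this

/-- If a tail of null probability `v` has an excess mass under `Q` that beats the binomial standard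
deviation by a factor `b ^ 4`, the statistic is large with high probability under `Q`. -/
lemma alt_statistic_bound {P₀ : Measure ℝ} (Q : Measure ℝ)
    [IsProbabilityMeasure Q] {s c : ℝ} (hc0 : 0 < c)
    (hc : ∀ ρ x : ℝ, 0 ≤ ρ → 1 + ρ ≤ x → c * min ρ (ρ ^ 2) ≤ phi s x)
    {n : ℕ} {v b : ℝ} {A : Set ℝ} (hA : IsTail P₀ v A) (hb : 4 ≤ b)
    (hv : 1 ≤ n * v) (hv2 : v ≤ 1 / 2) (hQ : Q.real A ≤ 3 / 4)
    (hD : b ^ 4 * √(n * v) ≤ n * (Q.real A - v)) {r : ℝ} (hr : r < c * b ^ 4 / (4 * n)) :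
    (Measure.pi fun _ : Fin n => Q) {x | (r : EReal) < S P₀ s x}ᶜ
      ≤ ENNReal.ofReal (2 * Real.exp (1 - b) + (3 / 4) ^ n) := by
  have hAm := hA.measurableSet
  set q := Q.real A with hq
  set D := n * (q - v) with hDdef
  set m := n * v with hm
  have hb0 : 0 < b := by linarith
  have hn0 : (0 : ℝ) < n := by
    rcases (Nat.cast_nonneg n : (0 : ℝ) ≤ n).eq_or_lt with h | h
    · rw [hm, ← h] at hv; linarith
    · exact h
  have hv0 : 0 < v := by
    by_contra hneg
    nlinarith
  have hsm1 : 1 ≤ √m := Real.one_le_sqrt.2 hv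
  have hsm : √m * √m = m := Real.mul_self_sqrt (by linarith)
  have hDb : b ^ 4 ≤ D := le_trans (le_mul_of_one_le_right (by positivity) hsm1) hD
  have hD0 : 0 < D := lt_of_lt_of_le (by positivity) hDb
  have hsD : √D * √D = D := Real.mul_self_sqrt hD0.le
  have hsDb : b ^ 2 ≤ √D := Real.le_sqrt_of_sq_le (by rw [← pow_mul]; exact hDb)
  have hnq : n * q = m + D := by rw [hDdef, hm]; ring
  have hnq1 : 1 ≤ m + D := by linarith
  -- the noise is at most half of the signal `D`
  have hnoise : b * √(max (m + D) 1) ≤ D / 2 := by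
    rw [max_eq_left hnq1]
    have e1 : √(m + D) ≤ √m + √D := by
      rw [Real.sqrt_le_left (by positivity)]
      nlinarith [mul_nonneg (Real.sqrt_nonneg m) (Real.sqrt_nonneg D)]
    have e2 : b * √m ≤ D / 4 := by
      have : 4 * b ≤ b ^ 4 := by nlinarith [pow_pos hb0 2, pow_pos hb0 3]
      nlinarith
    have e3 : b * √D ≤ D / 4 := by
      have : 4 * b ≤ √D := by nlinarith
      nlinarith
    nlinarith
  have hsub : {x : Fin n → ℝ | (r : EReal) < S P₀ s x}ᶜ ⊆
      {x | b * √(max (m + D) 1) ≤ |count A x - (m + D)|} ∪ univ.pi fun _ => A := by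
    intro x hx
    by_contra hnot
    simp only [mem_union, not_or, mem_ofPred_eq, not_le] at hnot
    obtain ⟨h1, h2⟩ := hnot
    refine hx ?_
    obtain ⟨i, hi⟩ : ∃ i, x i ∉ A := by simpa [Set.mem_pi] using h2
    have hcn : count A x < n := by
      have := one_le_count (A := Aᶜ) (x := x) hi
      rw [count_compl] at this; linarith
    have hN : m + D / 2 ≤ count A x := by linarith [(abs_lt.1 h1).1]
    have hN0 : 0 < count A x := by linarith
    refine lt_of_lt_of_le (EReal.coe_lt_coe_iff.2 ?_) (hA.K_le_S s hN0 hcn)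
    set ρ := b ^ 4 / (2 * √m) with hρ
    have hρ0 : 0 ≤ ρ := by positivity
    have hsm0 : 0 < √m := by linarith
    have hvρ : n * (v * ρ) = b ^ 4 * √m / 2 := by
      rw [← mul_assoc, ← hm, hρ]
      nth_rewrite 1 [← hsm]
      field_simp
    have hu : v * (1 + ρ) ≤ count A x / n := by
      rw [le_div_iff₀ hn0]
      calc v * (1 + ρ) * n = n * v + n * (v * ρ) := by ring
        _ = m + b ^ 4 * √m / 2 := by rw [hvρ]
        _ ≤ _ := by linarith
    refine lt_of_lt_of_le ?_ (K_lower hv0 (by linarith) (by rw [div_lt_one hn0]; exact hcn)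
      hρ0 hc hu)
    refine lt_of_lt_of_le hr ?_
    rw [div_le_iff₀ (by positivity)]
    have hmin : b ^ 4 / 4 ≤ n * (v * min ρ (ρ ^ 2)) := by
      rw [mul_min_of_nonneg _ _ hv0.le, mul_min_of_nonneg _ _ hn0.le]
      refine le_min ?_ ?_
      · rw [hvρ]
        have : b ^ 4 ≤ b ^ 4 * √m := le_mul_of_one_le_right (by positivity) hsm1
        have : 0 < b ^ 4 := by positivity
        linarith
      · rw [sq, ← mul_assoc, ← mul_assoc, mul_assoc (n : ℝ), hvρ, hρ]
        have e : b ^ 4 * √m / 2 * (b ^ 4 / (2 * √m)) = b ^ 4 * b ^ 4 / 4 := by field_simp; norm_num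
        rw [e]
        have : 1 ≤ b ^ 4 := one_le_pow₀ (by linarith)
        have : b ^ 4 ≤ b ^ 4 * b ^ 4 := le_mul_of_one_le_right (by positivity) this
        linarith
    nlinarith
  refine (measure_mono hsub).trans ((measure_union_le _ _).trans ?_)
  refine (add_le_add (count_deviation Q hAm n b hnq) (le_of_eq (Measure.pi_pi _ _))).trans ?_
  rw [Finset.prod_const, Finset.card_univ, Fintype.card_fin, ← ofReal_measureReal,
    ← ENNReal.ofReal_pow measureReal_nonneg, ← ENNReal.ofReal_add (by positivity) (by positivity)]
  refine ENNReal.ofReal_le_ofReal ?_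
  gcongr

/-! ### Location of the signal -/

/-- The larger of the two values of the density `g` at the quantiles of orders `x ^ (-t)` and
`1 - x ^ (-t)`. -/
noncomputable def peak (P₀ : Measure ℝ) (g : ℝ → ℝ≥0∞) (x t : ℝ) : ℝ≥0∞ :=
  max (g (quantile P₀ (x ^ (-t)))) (g (quantile P₀ (1 - x ^ (-t))))

section Signal

variable {P₀ : Measure ℝ} {g : ℝ → ℝ≥0∞} {x : ℝ}

lemma measurable_peak (hg : Measurable g) : Measurable (peak P₀ g x) := by
  have h1 : Measurable fun t : ℝ => x ^ (-t) := by fun_prop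
  have h2 : Measurable fun t : ℝ => 1 - x ^ (-t) := by fun_prop
  exact (hg.comp (measurable_quantile.comp h1)).max (hg.comp (measurable_quantile.comp h2))

variable [IsProbabilityMeasure P₀]

/-- Pigeonhole over the values of `min t 1`: if the density is at least
`x ^ (r - 1 / 2 + t - min t 1 / 2)` for a set of exponents `t` of measure at least `m`, then some
pair of opposite tails carries a large mass. -/
lemma exists_tail_mass (hx : 2 ≤ x) (hg : Measurable g) {r m : ℝ}
    {J : ℕ} (hJ : 0 < J)
    (hT : ENNReal.ofReal m ≤ volume {t : ℝ | Real.log 2 / Real.log x ≤ t ∧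
      ENNReal.ofReal (x ^ (r - 1 / 2 + t - min t 1 / 2)) ≤ peak P₀ g x t}) :
    ∃ a ∈ Icc (Real.log 2 / Real.log x) 1,
      ENNReal.ofReal (m / (J + 1) * (Real.log x * x ^ (r - 1 / 2 - a / 2 - 1 / (2 * J))))
        ≤ P₀.withDensity g (Iic (quantile P₀ (x ^ (-a))))
          + P₀.withDensity g (Ici (quantile P₀ (1 - x ^ (-a)))) := by
  have hx1 : 1 < x := by linarith
  have hx0 : 0 < x := by linarith
  have hL := Real.log_pos hx1
  have hJ0 : (0 : ℝ) < J := Nat.cast_pos.2 hJ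
  set a₀ := Real.log 2 / Real.log x with ha₀
  have ha₀0 : 0 < a₀ := div_pos (Real.log_pos (by norm_num)) hL
  have ha₀1 : a₀ ≤ 1 := (div_le_one hL).2 (Real.log_le_log (by norm_num) hx)
  set T := {t : ℝ | a₀ ≤ t ∧
      ENNReal.ofReal (x ^ (r - 1 / 2 + t - min t 1 / 2)) ≤ peak P₀ g x t} with hTdef
  have hTm : MeasurableSet T := by
    refine measurableSet_Ici.inter (measurableSet_le ?_ (measurable_peak hg))
    have : Measurable fun t : ℝ => x ^ (r - 1 / 2 + t - min t 1 / 2) := by fun_prop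
    exact this.ennreal_ofReal
  let U : ℕ → Set ℝ := fun j => T ∩ ({t | (j : ℝ) ≤ J * min t 1} ∩ {t | J * min t 1 < j + 1})
  have hUm : ∀ j, MeasurableSet (U j) := fun j => by
    refine hTm.inter ((measurableSet_le ?_ ?_).inter (measurableSet_lt ?_ ?_)) <;> fun_prop
  have hcover : T ⊆ ⋃ j ∈ Finset.range (J + 1), U j := by
    intro t ht
    have hmin : 0 < min t 1 := lt_min (ha₀0.trans_le ht.1) one_pos
    have h0 : 0 ≤ J * min t 1 := by positivity
    simp only [mem_iUnion]
    refine ⟨⌊J * min t 1⌋₊, ?_, ht, Nat.floor_le h0, Nat.lt_floor_add_one (J * min t 1)⟩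
    rw [Finset.mem_range, Nat.lt_succ_iff]
    refine Nat.floor_le_of_le ?_
    exact mul_le_of_le_one_right hJ0.le (min_le_right _ _)
  obtain ⟨j, hj, hjm⟩ : ∃ j ∈ Finset.range (J + 1),
      ENNReal.ofReal (m / (J + 1)) ≤ volume (U j) := by
    refine ENNReal.exists_le_of_sum_le (s := Finset.range (J + 1)) ⟨0, by simp⟩ ?_
    refine le_trans (le_of_eq ?_) (hT.trans ((measure_mono hcover).trans
      (measure_biUnion_finset_le _ _)))
    rw [Finset.sum_const, Finset.card_range, nsmul_eq_mul, ← ENNReal.ofReal_natCast,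
      ← ENNReal.ofReal_mul (by positivity)]
    congr 1
    push_cast
    field_simp
  have hjJ : (j : ℝ) ≤ J := by exact_mod_cast Nat.lt_succ_iff.1 (Finset.mem_range.1 hj)
  refine ⟨max (j / J) a₀, ⟨le_max_right _ _, max_le ((div_le_one hJ0).2 hjJ) ha₀1⟩, ?_⟩
  set a := max ((j : ℝ) / J) a₀ with ha
  have hva := rpow_neg_mem_Ioc hx1 (le_max_right _ _ : a₀ ≤ a)
  set v := x ^ (-a) with hv
  set G : ℝ → ℝ≥0∞ := (Iic (quantile P₀ v)).indicator g + (Ici (quantile P₀ (1 - v))).indicator g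
    with hG
  have hGm : Measurable G := (hg.indicator measurableSet_Iic).add (hg.indicator measurableSet_Ici)
  have hGint : ∫⁻ y, G y ∂P₀ = P₀.withDensity g (Iic (quantile P₀ v))
      + P₀.withDensity g (Ici (quantile P₀ (1 - v))) := by
    rw [hG, withDensity_apply _ measurableSet_Iic, withDensity_apply _ measurableSet_Ici,
      ← lintegral_indicator measurableSet_Iic, ← lintegral_indicator measurableSet_Ici,
      ← lintegral_add_left (hg.indicator measurableSet_Iic)]
    rfl
  rw [← hGint, lintegral_eq_quantile hx1 hGm]
  have hUsub : U j ⊆ Ici a₀ := fun t ht => ht.1.1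
  refine le_trans ?_ (lintegral_mono_set hUsub)
  rw [mul_comm, ENNReal.ofReal_mul (by positivity)]
  refine le_trans (mul_le_mul_right hjm _) ?_
  rw [← setLIntegral_const]
  refine setLIntegral_mono' (hUm j) fun t ht => ?_
  obtain ⟨⟨ht1, ht2⟩, ht3, ht4⟩ := ht
  have hta : a ≤ t := max_le (((div_le_iff₀' hJ0).2 ht3).trans (min_le_left _ _)) ht1
  have hmin : min t 1 ≤ a + 1 / J := by
    have : min t 1 < (j + 1) / J := (lt_div_iff₀' hJ0).2 ht4
    rw [add_div] at this
    linarith [le_max_left ((j : ℝ) / J) a₀]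
  have hut := rpow_neg_mem_Ioc hx1 ht1
  have huv : x ^ (-t) ≤ v := Real.rpow_le_rpow_of_exponent_le hx1.le (by linarith)
  have hIoo : ∀ u ∈ Ioc (0 : ℝ) (1 / 2), u ∈ Ioo (0 : ℝ) 1 ∧ 1 - u ∈ Ioo (0 : ℝ) 1 := by
    rintro u ⟨h1, h2⟩
    exact ⟨⟨h1, by linarith⟩, by linarith, by linarith⟩
  have hG1 : g (quantile P₀ (x ^ (-t))) ≤ G (quantile P₀ (x ^ (-t))) := by
    have : quantile P₀ (x ^ (-t)) ∈ Iic (quantile P₀ v) :=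
      quantile_mono (hIoo _ hut).1 (hIoo _ hva).1 huv
    rw [hG, Pi.add_apply, indicator_of_mem this]
    exact le_self_add
  have hG2 : g (quantile P₀ (1 - x ^ (-t))) ≤ G (quantile P₀ (1 - x ^ (-t))) := by
    have : quantile P₀ (1 - x ^ (-t)) ∈ Ici (quantile P₀ (1 - v)) :=
      quantile_mono (hIoo _ hva).2 (hIoo _ hut).2 (by linarith)
    rw [hG, Pi.add_apply, indicator_of_mem this]
    exact le_add_self
  calc ENNReal.ofReal (Real.log x * x ^ (r - 1 / 2 - a / 2 - 1 / (2 * J)))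
      ≤ ENNReal.ofReal (Real.log x * x ^ (-t) * x ^ (r - 1 / 2 + t - min t 1 / 2)) := by
        refine ENNReal.ofReal_le_ofReal ?_
        rw [mul_assoc, ← Real.rpow_add hx0]
        gcongr
        · exact hx1.le
        · have : 1 / (2 * (J : ℝ)) = 1 / J / 2 := by field_simp
          rw [this]; linarith
    _ = ENNReal.ofReal (Real.log x * x ^ (-t)) *
          ENNReal.ofReal (x ^ (r - 1 / 2 + t - min t 1 / 2)) :=
        ENNReal.ofReal_mul (by positivity)
    _ ≤ _ := by
        refine mul_le_mul_right (ht2.trans ?_) _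
        exact (max_le_add_of_nonneg zero_le zero_le).trans (add_le_add hG1 hG2)

/-- Below the threshold, the excess mass of the alternative in some tail beats the standard
deviation of the count under the null by a power of `n`. -/
lemma eventually_signal [NullSingletonClass P₀] {f : ℕ → ℝ → ℝ≥0∞}
    (hf : ∀ n, Measurable (f n)) [∀ n, IsProbabilityMeasure (P₀.withDensity (f n))]
    {β b : ℝ} (hβ : 1 / 2 < β) (hβb : β < b)
    (hpos : ∀ δ : ℝ, 0 < δ → ∃ m : ℝ, 0 < m ∧ ∀ᶠ n : ℕ in atTop,
      ENNReal.ofReal m ≤ volume {t : ℝ | Real.log 2 / Real.log n ≤ t ∧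
        ENNReal.ofReal ((n : ℝ) ^ (b - δ - 1 / 2 + t - min t 1 / 2)) ≤ peak P₀ (f n) n t}) :
    ∃ κ : ℝ, 0 < κ ∧ ∀ᶠ n : ℕ in atTop, ∃ v A, IsTail P₀ v A ∧ 1 ≤ n * v ∧ v ≤ 1 / 2 ∧
      (n : ℝ) ^ κ * √(n * v)
        ≤ n * ((n : ℝ) ^ (-β) * ((P₀.withDensity (f n)).real A - v)) := by
  set κ := (b - β) / 4 with hκ
  have hκ0 : 0 < κ := by rw [hκ]; linarith
  -- with `r = b - 2 κ` the exponent `r - 1 / (2 J)` is at least `β + κ`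
  obtain ⟨m, hm, hmn⟩ := hpos (2 * κ) (by positivity)
  obtain ⟨J, hJ⟩ := exists_nat_gt (1 / (2 * κ))
  have hJ0 : (0 : ℝ) < J := lt_trans (by positivity) hJ
  have hJκ : 1 / (2 * (J : ℝ)) ≤ κ := by
    rw [div_lt_iff₀ (by positivity)] at hJ
    rw [div_le_iff₀ (by positivity)]
    linarith
  have hc0 : 0 < m / (J + 1) := by positivity
  have hlog : Tendsto (fun n : ℕ => m / (J + 1) * Real.log n) atTop atTop :=
    (Real.tendsto_log_atTop.comp tendsto_natCast_atTop_atTop).const_mul_atTop hc0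
  refine ⟨κ, hκ0, ?_⟩
  filter_upwards [hmn, hlog.eventually_ge_atTop 4, eventually_ge_atTop 2] with n hT h4 hn2
  have hn2' : (2 : ℝ) ≤ n := by exact_mod_cast hn2
  have hn1 : (1 : ℝ) < n := by linarith
  have hn0 : (0 : ℝ) < n := by linarith
  obtain ⟨a, ⟨ha0, ha1⟩, hmass⟩ := exists_tail_mass hn2' (hf n) (Nat.cast_pos.1 hJ0) hT
  have hv := rpow_neg_mem_Ioc hn1 ha0
  have hapos : 0 < a := lt_of_lt_of_le (div_pos (Real.log_pos (by norm_num)) (Real.log_pos hn1)) ha0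
  set v := (n : ℝ) ^ (-a) with hvdef
  set z := (n : ℝ) ^ (β - 1 / 2 + κ - a / 2) with hz
  have hz0 : 0 < z := Real.rpow_pos_of_pos hn0 _
  have hvz : v ≤ z := Real.rpow_le_rpow_of_exponent_le hn1.le (by linarith)
  have hnv : (n : ℝ) * v = n ^ (1 - a) := by
    rw [hvdef, sub_eq_add_neg, Real.rpow_add hn0, Real.rpow_one]
  have hB : ENNReal.ofReal (2 * z) + ENNReal.ofReal (2 * z)
      ≤ ENNReal.ofReal (m / (J + 1) *
          (Real.log n * (n : ℝ) ^ (b - 2 * κ - 1 / 2 - a / 2 - 1 / (2 * J)))) := by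
    rw [← ENNReal.ofReal_add (by positivity) (by positivity)]
    refine ENNReal.ofReal_le_ofReal ?_
    have : z ≤ (n : ℝ) ^ (b - 2 * κ - 1 / 2 - a / 2 - 1 / (2 * J)) :=
      Real.rpow_le_rpow_of_exponent_le hn1.le (by rw [hκ] at *; linarith)
    calc 2 * z + 2 * z = 4 * z := by ring
      _ ≤ (m / (J + 1) * Real.log n) * z := by gcongr
      _ ≤ (m / (J + 1) * Real.log n) *
            (n : ℝ) ^ (b - 2 * κ - 1 / 2 - a / 2 - 1 / (2 * J)) := by
          refine mul_le_mul_of_nonneg_left this ?_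
          linarith
      _ = _ := by ring
  have hvI : v ∈ Ioo (0 : ℝ) 1 := ⟨hv.1, by linarith [hv.2]⟩
  have hvI' : 1 - v ∈ Ioo (0 : ℝ) 1 := ⟨by linarith [hv.2], by linarith [hv.1]⟩
  have hIoi : P₀.withDensity (f n) (Ioi (quantile P₀ (1 - v)))
      = P₀.withDensity (f n) (Ici (quantile P₀ (1 - v))) := by
    refine measure_congr ((withDensity_absolutelyContinuous P₀ (f n)).ae_le ?_)
    exact Ioi_ae_eq_Ici
  obtain ⟨A, hA, hAmass⟩ : ∃ A, IsTail P₀ v A ∧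
      ENNReal.ofReal (2 * z) ≤ P₀.withDensity (f n) A := by
    rcases le_or_gt (ENNReal.ofReal (2 * z)) (P₀.withDensity (f n) (Iic (quantile P₀ v))) with h | h
    · exact ⟨_, ⟨_, Or.inl ⟨rfl, cdf_quantile hvI⟩⟩, h⟩
    · refine ⟨_, ⟨_, Or.inr ⟨rfl, cdf_quantile hvI'⟩⟩, ?_⟩
      rw [hIoi]
      by_contra hlt
      exact absurd (hB.trans hmass) (not_le.2 (ENNReal.add_lt_add h (not_le.1 hlt)))
  refine ⟨v, A, hA, ?_, hv.2, ?_⟩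
  · rw [hnv]; exact Real.one_le_rpow hn1.le (by linarith)
  · have hAz : 2 * z ≤ (P₀.withDensity (f n)).real A :=
      (ENNReal.ofReal_le_iff_le_toReal (measure_ne_top _ _)).1 hAmass
    have hsq : √(n * v) = (n : ℝ) ^ ((1 - a) / 2) := by
      rw [hnv, Real.sqrt_eq_rpow, ← Real.rpow_mul hn0.le]; congr 1; ring
    calc (n : ℝ) ^ κ * √(n * v) = n * ((n : ℝ) ^ (-β) * z) := by
          rw [hsq, hz, ← Real.rpow_add hn0, ← Real.rpow_add hn0]
          nth_rewrite 2 [← Real.rpow_one (n : ℝ)]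
          rw [← Real.rpow_add hn0]
          congr 1; ring
      _ ≤ _ := by gcongr; linarith

end Signal

/-! ### Complete separation below the threshold -/

lemma tendsto_natCast_rpow_atTop {κ : ℝ} (hκ : 0 < κ) :
    Tendsto (fun n : ℕ => (n : ℝ) ^ κ) atTop atTop :=
  (tendsto_rpow_atTop hκ).comp tendsto_natCast_atTop_atTop

lemma tendsto_exp_one_sub_rpow {κ : ℝ} (hκ : 0 < κ) :
    Tendsto (fun n : ℕ => Real.exp (1 - (n : ℝ) ^ κ)) atTop (𝓝 0) :=
  Real.tendsto_exp_atBot.comp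
    (tendsto_atBot_add_const_left _ 1
      (tendsto_neg_atTop_atBot.comp (tendsto_natCast_rpow_atTop hκ)))

lemma tendsto_mul_exp_one_sub_rpow {κ : ℝ} (hκ : 0 < κ) :
    Tendsto (fun n : ℕ => ((n : ℝ) + 1) * Real.exp (1 - (n : ℝ) ^ κ)) atTop (𝓝 0) := by
  have h1 := (tendsto_rpow_mul_exp_neg_mul_atTop_nhds_zero (1 / κ) 1 one_pos).comp
    (tendsto_natCast_rpow_atTop hκ)
  have h2 := (h1.const_mul (Real.exp 1)).add (tendsto_exp_one_sub_rpow hκ)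
  rw [mul_zero, add_zero] at h2
  refine h2.congr fun n => ?_
  simp only [Function.comp_apply]
  rw [← Real.rpow_mul (Nat.cast_nonneg n), mul_one_div_cancel hκ.ne', Real.rpow_one, sub_eq_add_neg,
    Real.exp_add, neg_mul, one_mul]
  ring

/-- Below the threshold the test based on `S_n(s)` with a critical value of order `n ^ (-1 + κ / 2)`
is completely separating. -/
theorem statistic_separates {P₀ : Measure ℝ} [IsProbabilityMeasure P₀] [NullSingletonClass P₀]
    {μ : ℕ → Measure ℝ} [∀ n, IsProbabilityMeasure (μ n)] {β : ℝ} (hβ : 1 / 2 < β) {κ : ℝ}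
    (hκ : 0 < κ)
    (hsig : ∀ᶠ n : ℕ in atTop, ∃ v A, IsTail P₀ v A ∧ 1 ≤ n * v ∧ v ≤ 1 / 2 ∧
      (n : ℝ) ^ κ * √(n * v) ≤ n * ((n : ℝ) ^ (-β) * ((μ n).real A - v))) (s : ℝ) :
    ∃ c : ℕ → ℝ, CompletelySeparates P₀ μ β fun n =>
      {x | ((c n : ℝ) : EReal) < S P₀ s x} := by
  set e := 5 + 3 * |s - 2| with he
  have he0 : 0 < e := by positivity
  -- under the null the statistic is at most `2 (n ^ κ') ^ e / n = 2 n ^ (κ / 2) / n`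
  set κ' := κ / 2 / e with hκ'
  have hκ'0 : 0 < κ' := by positivity
  obtain ⟨c, hc0, hc⟩ := exists_phi_lower s
  refine ⟨fun n => 2 * ((n : ℝ) ^ κ') ^ e / n, ?_⟩
  have hκ4 : 0 < κ / 4 := by positivity
  have hlim1 : Tendsto (fun n : ℕ => 4 * ((n : ℝ) + 1) * Real.exp (1 - (n : ℝ) ^ κ')
      + 2 / (n : ℝ) ^ κ') atTop (𝓝 0) := by
    have h1 := (tendsto_mul_exp_one_sub_rpow hκ'0).const_mul 4
    have h2 := (tendsto_natCast_rpow_atTop hκ'0).const_div_atTop 2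
    have h3 := h1.add h2
    rw [mul_zero, add_zero] at h3
    refine h3.congr fun n => by ring
  have hlim2 : Tendsto (fun n : ℕ => 2 * Real.exp (1 - (n : ℝ) ^ (κ / 4)) + (3 / 4 : ℝ) ^ n)
      atTop (𝓝 0) := by
    have h1 := (tendsto_exp_one_sub_rpow hκ4).const_mul 2
    have h2 := tendsto_pow_atTop_nhds_zero_of_lt_one (r := (3 / 4 : ℝ)) (by norm_num) (by norm_num)
    have h3 := h1.add h2
    rwa [mul_zero, add_zero] at h3
  have hlim := (ENNReal.tendsto_ofReal hlim1).add (ENNReal.tendsto_ofReal hlim2)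
  rw [ENNReal.ofReal_zero, add_zero] at hlim
  have hε : Tendsto (fun n : ℕ => (n : ℝ) ^ (-β)) atTop (𝓝 0) :=
    (tendsto_rpow_neg_atTop (by linarith)).comp tendsto_natCast_atTop_atTop
  refine tendsto_of_tendsto_of_tendsto_of_le_of_le' tendsto_const_nhds hlim
    (Eventually.of_forall fun _ => zero_le) ?_
  filter_upwards [hsig, eventually_gt_atTop 0,
    (tendsto_natCast_rpow_atTop hκ'0).eventually_ge_atTop 38,
    (tendsto_natCast_rpow_atTop hκ4).eventually_ge_atTop 4,
    (tendsto_natCast_rpow_atTop (half_pos hκ)).eventually_gt_atTop (8 / c),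
    hε.eventually_le_const (show (0 : ℝ) < 1 / 4 by norm_num)]
    with n ⟨v, A, hA, hnv, hv2, hD⟩ hn hb' hb hbig hε4
  have hn0 : (0 : ℝ) < n := Nat.cast_pos.2 hn
  obtain ⟨hε0, hε1⟩ := rpow_neg_nonneg_le_one (show 0 < β by linarith) n
  have hQ := isProbabilityMeasure_mixture P₀ (μ n) hε0 hε1
  refine add_le_add (null_statistic_bound P₀ s hn hb') ?_
  have hQA := mixture_real_apply P₀ (μ n) hε0 hε1 A
  rw [hA.real_eq] at hQA
  have hμA : (μ n).real A ≤ 1 := measureReal_le_one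
  have hμA0 : 0 ≤ (μ n).real A := measureReal_nonneg
  have hv0 : 0 ≤ v := by rw [← hA.real_eq]; exact measureReal_nonneg
  have hb4 : ((n : ℝ) ^ (κ / 4)) ^ 4 = (n : ℝ) ^ κ := by
    rw [← Real.rpow_natCast, ← Real.rpow_mul hn0.le]; congr 1; push_cast; ring
  have hbe : ((n : ℝ) ^ κ') ^ e = (n : ℝ) ^ (κ / 2) := by
    rw [← Real.rpow_mul hn0.le, hκ', div_mul_cancel₀ _ he0.ne']
  refine alt_statistic_bound (mixture P₀ (μ n) ((n : ℝ) ^ (-β))) hc0 hc hA hb hnv hv2 ?_ ?_ ?_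
  · rw [hQA]; nlinarith
  · rw [hQA, hb4]
    refine hD.trans (le_of_eq ?_)
    ring
  · rw [hbe, hb4, div_lt_div_iff₀ hn0 (by positivity)]
    have hsplit : (n : ℝ) ^ κ = (n : ℝ) ^ (κ / 2) * (n : ℝ) ^ (κ / 2) := by
      rw [← Real.rpow_add hn0]; congr 1; ring
    rw [div_lt_iff₀ hc0] at hbig
    have hp : 0 < (n : ℝ) ^ (κ / 2) := Real.rpow_pos_of_pos hn0 _
    rw [hsplit]
    have := mul_lt_mul_of_pos_right hbig hp
    nlinarith

/-! ### Indistinguishability by a truncated second moment -/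

lemma integral_abs_le_sqrt {Ω : Type*} [MeasurableSpace Ω] {P : Measure Ω} [IsProbabilityMeasure P]
    {X : Ω → ℝ} (hX : Integrable X P) (hX2 : Integrable (fun x => X x ^ 2) P) :
    ∫ x, |X x| ∂P ≤ √(∫ x, X x ^ 2 ∂P) := by
  set c := ∫ x, |X x| ∂P with hc
  refine Real.le_sqrt_of_sq_le ?_
  have h0 : 0 ≤ ∫ x, (|X x| - c) ^ 2 ∂P := integral_nonneg fun x => sq_nonneg _
  have h1 : ∀ x, (|X x| - c) ^ 2 = X x ^ 2 - 2 * c * |X x| + c ^ 2 := fun x => by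
    rw [← sq_abs (X x)]; ring
  simp only [h1] at h0
  have h2 : Integrable (fun x => X x ^ 2 - 2 * c * |X x|) P := hX2.sub (hX.abs.const_mul _)
  rw [integral_add h2 (integrable_const _), integral_sub hX2 (hX.abs.const_mul _), integral_const_mul,
    ← hc] at h0
  simp only [integral_const, probReal_univ, smul_eq_mul, one_mul] at h0
  nlinarith

/-- The sum of the error probabilities of any test is close to `1` if the likelihood ratio `L` has a
minorant `L'` with almost the same mass and second moment close to `1`. -/
lemma abs_error_sum_sub_one_le {Ω : Type*} [MeasurableSpace Ω] {P : Measure Ω}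
    [IsProbabilityMeasure P] {L L' φ : Ω → ℝ} (hLm : Measurable L) (hL : Integrable L P)
    (hL1 : ∫ x, L x ∂P = 1) (hL' : Integrable L' P) (hL'2 : Integrable (fun x => L' x ^ 2) P)
    (hL'0 : ∀ x, 0 ≤ L' x) (hle : ∀ x, L' x ≤ L x) {η ζ : ℝ} (hη : 1 - η ≤ ∫ x, L' x ∂P)
    (hζ : ∫ x, L' x ^ 2 ∂P ≤ 1 + ζ) (hφ : Measurable φ) (hφ01 : ∀ x, φ x ∈ Icc (0 : ℝ) 1) :
    |(∫ x, φ x ∂P) + (∫ x, (1 - φ x) ∂(P.withDensity fun x => ENNReal.ofReal (L x))) - 1|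
      ≤ η + √(ζ + 2 * η) := by
  have hL0 : ∀ x, 0 ≤ L x := fun x => (hL'0 x).trans (hle x)
  have hφint : Integrable φ P := Integrable.of_bound hφ.aestronglyMeasurable 1
    (ae_of_all _ fun x => by
      rw [Real.norm_eq_abs, abs_of_nonneg (hφ01 x).1]; exact (hφ01 x).2)
  have hLφ : Integrable (fun x => L x * φ x) P :=
    hL.mul_bdd (c := 1) hφ.aestronglyMeasurable (ae_of_all _ fun x => by
      rw [Real.norm_eq_abs, abs_of_nonneg (hφ01 x).1]; exact (hφ01 x).2)
  have hden : ∫ x, (1 - φ x) ∂(P.withDensity fun x => ENNReal.ofReal (L x))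
      = 1 - ∫ x, L x * φ x ∂P := by
    rw [integral_withDensity_eq_integral_toReal_smul hLm.ennreal_ofReal
      (ae_of_all _ fun x => ENNReal.ofReal_lt_top)]
    simp only [ENNReal.toReal_ofReal (hL0 _), smul_eq_mul, mul_sub, mul_one]
    rw [integral_sub hL hLφ, hL1]
  have hdiff : (∫ x, φ x ∂P) + (1 - ∫ x, L x * φ x ∂P) - 1 = ∫ x, (φ x - L x * φ x) ∂P := by
    rw [integral_sub hφint hLφ]; ring
  have hX : Integrable (fun x => L' x - 1) P := hL'.sub (integrable_const 1)
  have hsq : ∀ x, (L' x - 1) ^ 2 = L' x ^ 2 - 2 * L' x + 1 := fun x => by ring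
  have hX2 : Integrable (fun x => (L' x - 1) ^ 2) P := by
    simp only [hsq]
    exact (hL'2.sub (hL'.const_mul 2)).add (integrable_const 1)
  have hquad : Integrable (fun x => L' x ^ 2 - 2 * L' x) P := hL'2.sub (hL'.const_mul 2)
  have hLL' : Integrable (fun x => L x - L' x) P := hL.sub hL'
  have hXint : ∫ x, (L' x - 1) ^ 2 ∂P ≤ ζ + 2 * η := by
    simp only [hsq]
    rw [integral_add hquad (integrable_const 1), integral_sub hL'2 (hL'.const_mul 2),
      integral_const_mul]
    simp only [integral_const, probReal_univ, smul_eq_mul, one_mul]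
    linarith
  have hpt : ∀ x, |φ x - L x * φ x| ≤ (L x - L' x) + |L' x - 1| := by
    intro x
    have h1 : φ x - L x * φ x = -(φ x * ((L x - L' x) + (L' x - 1))) := by ring
    rw [h1, abs_neg, abs_mul, abs_of_nonneg (hφ01 x).1]
    refine (mul_le_of_le_one_left (abs_nonneg _) (hφ01 x).2).trans ((abs_add_le _ _).trans ?_)
    rw [abs_of_nonneg (sub_nonneg.2 (hle x))]
  rw [hden, hdiff]
  calc |∫ x, (φ x - L x * φ x) ∂P| ≤ ∫ x, |φ x - L x * φ x| ∂P := abs_integral_le_integral_abs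
    _ ≤ ∫ x, ((L x - L' x) + |L' x - 1|) ∂P :=
        integral_mono (hφint.sub hLφ).abs (hLL'.add hX.abs) hpt
    _ = (1 - ∫ x, L' x ∂P) + ∫ x, |L' x - 1| ∂P := by
        rw [integral_add hLL' hX.abs, integral_sub hL hL', hL1]
    _ ≤ η + √(ζ + 2 * η) :=
        add_le_add (by linarith) ((integral_abs_le_sqrt hX hX2).trans (Real.sqrt_le_sqrt hXint))

/-- The product version of `abs_error_sum_sub_one_le`, from the moments of a single factor. -/
lemma abs_error_sum_pi_le {P : Measure ℝ} [IsProbabilityMeasure P] {q q' : ℝ → ℝ}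
    [IsFiniteMeasure (P.withDensity fun y => ENNReal.ofReal (q y))]
    (hqm : Measurable q) (hqint : Integrable q P) (hq1 : ∫ y, q y ∂P = 1)
    (hq'int : Integrable q' P) (hq'2int : Integrable (fun y => q' y ^ 2) P)
    (hq'0 : ∀ y, 0 ≤ q' y) (hq'q : ∀ y, q' y ≤ q y) {w v : ℝ} (hq'1 : 1 - w ≤ ∫ y, q' y ∂P)
    (hq'2 : ∫ y, q' y ^ 2 ∂P ≤ Real.exp v) (n : ℕ) {φ : (Fin n → ℝ) → ℝ}
    (hφ : Measurable φ) (hφ01 : ∀ x, φ x ∈ Icc (0 : ℝ) 1) :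
    |(∫ x, φ x ∂(Measure.pi fun _ : Fin n => P)) + (∫ x, (1 - φ x)
        ∂(Measure.pi fun _ : Fin n => P.withDensity fun y => ENNReal.ofReal (q y))) - 1|
      ≤ n * w + √(Real.exp (n * v) - 1 + 2 * (n * w)) := by
  have hq0 : ∀ y, 0 ≤ q y := fun y => (hq'0 y).trans (hq'q y)
  have hlaw : (Measure.pi fun _ : Fin n => P.withDensity fun y => ENNReal.ofReal (q y))
      = (Measure.pi fun _ : Fin n => P).withDensity fun x => ENNReal.ofReal (∏ i, q (x i)) := by
    rw [pi_withDensity_eq hqm.ennreal_ofReal]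
    congr 1
    ext x
    rw [ENNReal.ofReal_prod_of_nonneg fun i _ => hq0 (x i)]
  have hprodm : Measurable fun x : Fin n → ℝ => ∏ i, q (x i) :=
    Finset.measurable_prod _ fun i _ => hqm.comp (measurable_pi_apply i)
  rw [hlaw]
  have hLint : Integrable (fun x : Fin n → ℝ => ∏ i, q (x i)) (Measure.pi fun _ => P) :=
    Integrable.fintype_prod (f := fun _ => q) fun _ => hqint
  have hL'int : Integrable (fun x : Fin n → ℝ => ∏ i, q' (x i)) (Measure.pi fun _ => P) :=
    Integrable.fintype_prod (f := fun _ => q') fun _ => hq'int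
  have hL'2int : Integrable (fun x : Fin n → ℝ => (∏ i, q' (x i)) ^ 2) (Measure.pi fun _ => P) := by
    simp only [← Finset.prod_pow]
    exact Integrable.fintype_prod (f := fun _ y => q' y ^ 2) fun _ => hq'2int
  have hL'0 : ∀ x : Fin n → ℝ, 0 ≤ ∏ i, q' (x i) := fun x =>
    Finset.prod_nonneg fun i _ => hq'0 _
  have hL'L : ∀ x : Fin n → ℝ, ∏ i, q' (x i) ≤ ∏ i, q (x i) := fun x =>
    Finset.prod_le_prod (fun i _ => hq'0 _) fun i _ => hq'q _
  have hL1 : ∫ x : Fin n → ℝ, ∏ i, q (x i) ∂(Measure.pi fun _ => P) = 1 := by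
    rw [integral_fintype_prod_eq_pow, hq1, one_pow]
  have hL'1 : 1 - n * w ≤ ∫ x : Fin n → ℝ, ∏ i, q' (x i) ∂(Measure.pi fun _ => P) := by
    rw [integral_fintype_prod_eq_pow, Fintype.card_fin]
    have hq'nn : 0 ≤ ∫ y, q' y ∂P := integral_nonneg hq'0
    have := one_add_mul_le_pow (a := (∫ y, q' y ∂P) - 1) (by linarith) n
    rw [add_sub_cancel] at this
    have h3 : (n : ℝ) * (-w) ≤ n * ((∫ y, q' y ∂P) - 1) := by gcongr; linarith
    linarith
  have hL'2 : ∫ x : Fin n → ℝ, (∏ i, q' (x i)) ^ 2 ∂(Measure.pi fun _ => P)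
      ≤ 1 + (Real.exp (n * v) - 1) := by
    simp only [← Finset.prod_pow]
    rw [integral_fintype_prod_eq_pow (f := fun y => q' y ^ 2), Fintype.card_fin, add_sub_cancel,
      Real.exp_nat_mul]
    exact pow_le_pow_left₀ (integral_nonneg fun y => sq_nonneg _) hq'2 n
  exact abs_error_sum_sub_one_le hprodm hLint hL1 hL'int hL'2int hL'0 hL'L hL'1 hL'2 hφ hφ01

/-- Truncation of the signal density to `A`: the error sum of every test is controlled by the mass
`W` of the signal outside `A` and the second moment `V` of its density on `A`. -/
lemma abs_error_sum_mixture_le {P : Measure ℝ} [IsProbabilityMeasure P] {f : ℝ → ℝ≥0∞}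
    (hf : Measurable f) [IsProbabilityMeasure (P.withDensity f)] {ε : ℝ} (h0 : 0 ≤ ε) (h1 : ε ≤ 1)
    {A : Set ℝ} (hA : MeasurableSet A) {V W : ℝ} (hW0 : 0 ≤ W) (hV0 : 0 ≤ V)
    (hV : ∫⁻ y in A, f y ^ 2 ∂P ≤ ENNReal.ofReal V)
    (hW : P.withDensity f Aᶜ ≤ ENNReal.ofReal W) (n : ℕ) {φ : (Fin n → ℝ) → ℝ}
    (hφ : Measurable φ) (hφ01 : ∀ x, φ x ∈ Icc (0 : ℝ) 1) :
    |(∫ x, φ x ∂(Measure.pi fun _ : Fin n => P))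
        + (∫ x, (1 - φ x) ∂(Measure.pi fun _ : Fin n => mixture P (P.withDensity f) ε)) - 1|
      ≤ n * ε * W + √(Real.exp (n * ε ^ 2 * V) - 1 + 2 * (n * ε * W)) := by
  set g : ℝ → ℝ := fun y => (f y).toReal with hg
  have hgm : Measurable g := hf.ennreal_toReal
  have hg0 : ∀ y, 0 ≤ g y := fun y => ENNReal.toReal_nonneg
  have hf1 : ∫⁻ y, f y ∂P = 1 := by
    rw [← setLIntegral_univ, ← withDensity_apply _ MeasurableSet.univ]
    exact measure_univ
  have hfin : ∀ᵐ y ∂P, f y < ∞ := ae_lt_top hf (by rw [hf1]; exact ENNReal.one_ne_top)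
  have hgint : Integrable g P := integrable_toReal_of_lintegral_ne_top hf.aemeasurable
    (by rw [hf1]; exact ENNReal.one_ne_top)
  have hg1 : ∫ y, g y ∂P = 1 := by
    rw [hg, integral_toReal hf.aemeasurable hfin, hf1, ENNReal.toReal_one]
  have hgA : 1 - W ≤ ∫ y, A.indicator g y ∂P := by
    rw [integral_indicator hA, hg, integral_toReal hf.aemeasurable (ae_restrict_of_ae hfin),
      ← withDensity_apply _ hA]
    have : (P.withDensity f).real Aᶜ ≤ W := ENNReal.toReal_le_of_le_ofReal hW0 hW
    rw [measureReal_compl hA, probReal_univ] at this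
    change 1 - W ≤ (P.withDensity f).real A
    linarith
  have hgA1 : ∫ y, A.indicator g y ∂P ≤ 1 := by
    rw [← hg1]
    exact integral_mono (hgint.indicator hA) hgint fun y => indicator_le_self' (fun y _ => hg0 y) y
  have hsqint : IntegrableOn (fun y => g y ^ 2) A P := by
    have := integrable_toReal_of_lintegral_ne_top (μ := P.restrict A)
      (hf.pow_const 2).aemeasurable (hV.trans_lt ENNReal.ofReal_lt_top).ne
    simp only [ENNReal.toReal_pow] at this
    exact this
  have hsq : ∫ y in A, g y ^ 2 ∂P ≤ V := by
    have e1 : ∫ y in A, g y ^ 2 ∂P = ∫ y in A, (f y ^ 2).toReal ∂P := by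
      simp only [ENNReal.toReal_pow, hg]
    rw [e1, integral_toReal (hf.pow_const 2).aemeasurable]
    · exact ENNReal.toReal_le_of_le_ofReal hV0 hV
    · filter_upwards [ae_restrict_of_ae hfin] with y hy
      exact ENNReal.pow_lt_top hy
  have hindsq : ∀ y, A.indicator g y ^ 2 = A.indicator (fun y => g y ^ 2) y := fun y => by
    by_cases hy : y ∈ A <;> simp [hy]
  set q : ℝ → ℝ := fun y => (1 - ε) + ε * g y with hq
  set q' : ℝ → ℝ := fun y => (1 - ε) + ε * A.indicator g y with hq'
  have hε1 : 0 ≤ 1 - ε := by linarith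
  have hqm : Measurable q := (hgm.const_mul ε).const_add _
  have hind0 : ∀ y, 0 ≤ A.indicator g y := fun y => indicator_nonneg (fun y _ => hg0 y) y
  have hq'0 : ∀ y, 0 ≤ q' y := fun y => add_nonneg hε1 (mul_nonneg h0 (hind0 y))
  have hq'q : ∀ y, q' y ≤ q y := fun y =>
    add_le_add_right (mul_le_mul_of_nonneg_left
      (indicator_le_self' (fun y _ => hg0 y) y) h0) (1 - ε)
  have hqint : Integrable q P := (integrable_const _).add (hgint.const_mul ε)
  have hq'int : Integrable q' P := (integrable_const _).add ((hgint.indicator hA).const_mul ε)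
  have hq1 : ∫ y, q y ∂P = 1 := by
    rw [hq, integral_add (integrable_const _) (hgint.const_mul ε), integral_const_mul, hg1]
    simp
  have hq'1 : 1 - ε * W ≤ ∫ y, q' y ∂P := by
    rw [hq', integral_add (integrable_const _) ((hgint.indicator hA).const_mul ε),
      integral_const_mul]
    simp only [integral_const, probReal_univ, smul_eq_mul, one_mul]
    nlinarith
  have hq'sq : ∀ y, q' y ^ 2 = ((1 - ε) ^ 2 + 2 * (1 - ε) * ε * A.indicator g y)
      + ε ^ 2 * A.indicator (fun y => g y ^ 2) y := fun y => by
    rw [← hindsq, hq']; ring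
  have i1 : Integrable (fun y => (1 - ε) ^ 2 + 2 * (1 - ε) * ε * A.indicator g y) P :=
    (integrable_const _).add ((hgint.indicator hA).const_mul _)
  have i2 : Integrable (fun y => ε ^ 2 * A.indicator (fun y => g y ^ 2) y) P :=
    ((integrable_indicator_iff hA).2 hsqint).const_mul _
  have hq'2int : Integrable (fun y => q' y ^ 2) P := by
    simp only [hq'sq]; exact i1.add i2
  have hq'2 : ∫ y, q' y ^ 2 ∂P ≤ Real.exp (ε ^ 2 * V) := by
    simp only [hq'sq]
    rw [integral_add i1 i2, integral_add (integrable_const _) ((hgint.indicator hA).const_mul _),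
      integral_const_mul, integral_const_mul, integral_indicator hA (f := fun y => g y ^ 2)]
    simp only [integral_const, probReal_univ, smul_eq_mul, one_mul]
    have e1 : 2 * (1 - ε) * ε * ∫ y, A.indicator g y ∂P ≤ 2 * (1 - ε) * ε * 1 := by gcongr
    have e2 : ε ^ 2 * ∫ y in A, g y ^ 2 ∂P ≤ ε ^ 2 * V := by gcongr
    have e3 := Real.add_one_le_exp (ε ^ 2 * V)
    nlinarith
  have hmix : mixture P (P.withDensity f) ε = P.withDensity fun y => ENNReal.ofReal (q y) := by
    rw [mixture_eq_withDensity P hf]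
    refine withDensity_congr_ae ?_
    filter_upwards [hfin] with y hy
    rw [hq, ENNReal.ofReal_add hε1 (mul_nonneg h0 (hg0 y)), ENNReal.ofReal_mul h0, hg,
      ENNReal.ofReal_toReal hy.ne]
  have hprob := isProbabilityMeasure_mixture P (P.withDensity f) h0 h1
  rw [hmix] at hprob ⊢
  have hfinal := abs_error_sum_pi_le hqm hqint hq1 hq'int hq'2int hq'0 hq'q hq'1 hq'2 n hφ hφ01
  simpa only [mul_assoc] using hfinal

/-! ### Upper bounds on the density and their consequences -/

lemma tendsto_log_mul_rpow_neg {c : ℝ} (hc : 0 < c) :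
    Tendsto (fun n : ℕ => Real.log n * (n : ℝ) ^ (-c)) atTop (𝓝 0) := by
  have h := ((isLittleO_log_rpow_atTop hc).tendsto_div_nhds_zero).comp
    tendsto_natCast_atTop_atTop
  refine h.congr fun n => ?_
  simp only [Function.comp_apply]
  rw [Real.rpow_neg (Nat.cast_nonneg n), div_eq_mul_inv]

section UpperBounds

variable {P₀ : Measure ℝ}

lemma lintegral_le_peak [IsProbabilityMeasure P₀] {x : ℝ} (hx : 1 < x) {g : ℝ → ℝ≥0∞}
    (hg : Measurable g) :
    ∫⁻ y, g y ∂P₀ ≤ ENNReal.ofReal (2 * Real.log x) *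
      ∫⁻ t in Ici (Real.log 2 / Real.log x), ENNReal.ofReal (x ^ (-t)) * peak P₀ g x t := by
  have hL := Real.log_pos hx
  rw [lintegral_eq_quantile hx hg, ← lintegral_const_mul' _ _ ENNReal.ofReal_ne_top]
  refine lintegral_mono fun t => ?_
  rw [ENNReal.ofReal_mul hL.le, ENNReal.ofReal_mul zero_le_two, ENNReal.ofReal_ofNat]
  have h2 : g (quantile P₀ (x ^ (-t))) + g (quantile P₀ (1 - x ^ (-t))) ≤ 2 * peak P₀ g x t := by
    rw [two_mul]; exact add_le_add (le_max_left _ _) (le_max_right _ _)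
  calc _ ≤ ENNReal.ofReal (Real.log x) * ENNReal.ofReal (x ^ (-t)) * (2 * peak P₀ g x t) :=
        mul_le_mul_right h2 _
    _ = _ := by ring

lemma lintegral_peak_le [IsProbabilityMeasure P₀] {x : ℝ} (hx : 1 < x) {g : ℝ → ℝ≥0∞}
    (hg : Measurable g) :
    ENNReal.ofReal (Real.log x) *
      ∫⁻ t in Ici (Real.log 2 / Real.log x), ENNReal.ofReal (x ^ (-t)) * peak P₀ g x t
      ≤ ∫⁻ y, g y ∂P₀ := by
  have hL := Real.log_pos hx
  rw [lintegral_eq_quantile hx hg, ← lintegral_const_mul' _ _ ENNReal.ofReal_ne_top]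
  refine lintegral_mono fun t => ?_
  rw [ENNReal.ofReal_mul hL.le, mul_assoc]
  exact mul_le_mul_right (mul_le_mul_right (max_le_add_of_nonneg zero_le zero_le) _) _

lemma log_two_div_log_le_one {x : ℝ} (hx : 2 ≤ x) : Real.log 2 / Real.log x ≤ 1 :=
  (div_le_one (Real.log_pos (by linarith))).2 (Real.log_le_log (by norm_num) hx)

/-- The region `t ≥ 1` corresponds to the extreme quantiles, beyond `1 / n` and `1 - 1 / n`. -/
lemma lintegral_extreme_le {g : ℝ → ℝ≥0∞} {b δ M x : ℝ} (hM : 1 ≤ M) (hx : 2 ≤ x)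
    (hzero : ∀ᵐ t : ℝ, Real.log 2 / Real.log x ≤ t →
      peak P₀ g x t ≤ ENNReal.ofReal (x ^ (b + δ - 1 / 2 + t - min t 1 / 2)))
    (htail : ∫⁻ t in Ici M, ENNReal.ofReal (x ^ (-t)) * peak P₀ g x t
      ≤ ENNReal.ofReal (x ^ (b - 1 + δ))) :
    ∫⁻ t in Ici 1, ENNReal.ofReal (x ^ (-t)) * peak P₀ g x t
      ≤ ENNReal.ofReal (M * x ^ (b - 1 + δ)) := by
  have hx0 : 0 < x := by linarith
  have hsub : Ici (1 : ℝ) ⊆ Icc 1 M ∪ Ici M := fun t ht =>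
    (le_total t M).imp (fun h => ⟨ht, h⟩) id
  have hmid : ∫⁻ t in Icc 1 M, ENNReal.ofReal (x ^ (-t)) * peak P₀ g x t
      ≤ ENNReal.ofReal ((M - 1) * x ^ (b - 1 + δ)) := by
    calc _ ≤ ∫⁻ _ in Icc 1 M, ENNReal.ofReal (x ^ (b - 1 + δ)) := by
          refine lintegral_mono_ae ?_
          filter_upwards [ae_restrict_of_ae hzero, ae_restrict_mem measurableSet_Icc] with t h1 h2
          refine (mul_le_mul_right (h1 ((log_two_div_log_le_one hx).trans h2.1)) _).trans ?_
          rw [← ENNReal.ofReal_mul (by positivity), ← Real.rpow_add hx0, min_eq_right h2.1]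
          refine ENNReal.ofReal_le_ofReal (le_of_eq ?_)
          congr 1; ring
      _ = _ := by
          rw [setLIntegral_const, Real.volume_Icc, ← ENNReal.ofReal_mul (by positivity), mul_comm]
  calc _ ≤ _ := lintegral_mono_set hsub
    _ ≤ _ := lintegral_union_le _ _ _
    _ ≤ _ := add_le_add hmid htail
    _ = _ := by
        rw [← ENNReal.ofReal_add (mul_nonneg (by linarith) (by positivity)) (by positivity)]
        congr 1; ring

variable [IsProbabilityMeasure P₀]

/-- The second moment of the density between the `1 / n` and `1 - 1 / n` quantiles, and the mass
beyond them. -/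
lemma truncation_bounds [NullSingletonClass P₀] {g : ℝ → ℝ≥0∞} (hg : Measurable g)
    {b δ M x : ℝ} (hx : 3 ≤ x)
    (hzero : ∀ᵐ t : ℝ, Real.log 2 / Real.log x ≤ t →
      peak P₀ g x t ≤ ENNReal.ofReal (x ^ (b + δ - 1 / 2 + t - min t 1 / 2)))
    (hextreme : ∫⁻ t in Ici 1, ENNReal.ofReal (x ^ (-t)) * peak P₀ g x t
      ≤ ENNReal.ofReal (M * x ^ (b - 1 + δ))) :
    ∃ A : Set ℝ, MeasurableSet A ∧
      ∫⁻ y in A, g y ^ 2 ∂P₀ ≤ ENNReal.ofReal (2 * Real.log x * x ^ (2 * b + 2 * δ - 1)) ∧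
      P₀.withDensity g Aᶜ ≤ ENNReal.ofReal (2 * Real.log x * (M * x ^ (b - 1 + δ))) := by
  have hx0 : 0 < x := by linarith
  have hx1 : 1 < x := by linarith
  have hL := Real.log_pos hx1
  have ha1 := log_two_div_log_le_one (show 2 ≤ x by linarith)
  set a₀ := Real.log 2 / Real.log x with ha₀
  let A : Set ℝ := {y | x⁻¹ < cdf P₀ y} ∩ {y | cdf P₀ y < 1 - x⁻¹}
  have hA : MeasurableSet A :=
    (measurableSet_lt measurable_const (monotone_cdf P₀).measurable).inter
      (measurableSet_lt (monotone_cdf P₀).measurable measurable_const)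
  have hxinv : x⁻¹ < 1 / 2 := by
    rw [inv_eq_one_div, div_lt_div_iff₀ hx0 (by norm_num)]; linarith
  have hmem : ∀ t, a₀ ≤ t → (quantile P₀ (x ^ (-t)) ∈ A ↔ t < 1) ∧
      (quantile P₀ (1 - x ^ (-t)) ∈ A ↔ t < 1) := by
    intro t ht
    obtain ⟨hu0, hu1⟩ := rpow_neg_mem_Ioc hx1 ht
    have hu : x ^ (-t) ∈ Ioo (0 : ℝ) 1 := ⟨hu0, by linarith⟩
    have hu' : 1 - x ^ (-t) ∈ Ioo (0 : ℝ) 1 := ⟨by linarith, by linarith⟩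
    have hiff : x⁻¹ < x ^ (-t) ↔ t < 1 := by
      rw [← Real.rpow_neg_one, Real.rpow_lt_rpow_left_iff hx1, neg_lt_neg_iff]
    rw [← hiff]
    change (x⁻¹ < cdf P₀ (quantile P₀ (x ^ (-t))) ∧ cdf P₀ (quantile P₀ (x ^ (-t))) < 1 - x⁻¹ ↔ _) ∧
      (x⁻¹ < cdf P₀ (quantile P₀ (1 - x ^ (-t))) ∧
        cdf P₀ (quantile P₀ (1 - x ^ (-t))) < 1 - x⁻¹ ↔ _)
    rw [cdf_quantile hu, cdf_quantile hu']
    constructor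
    · exact ⟨fun h => h.1, fun h => ⟨h, by linarith⟩⟩
    · exact ⟨fun h => by linarith [h.2], fun h => ⟨by linarith, by linarith⟩⟩
  refine ⟨A, hA, ?_, ?_⟩
  · rw [← lintegral_indicator hA, lintegral_eq_quantile hx1 ((hg.pow_const 2).indicator hA)]
    have hstep : ∀ᵐ t ∂(volume.restrict (Ici a₀)),
        ENNReal.ofReal (Real.log x * x ^ (-t)) *
          (A.indicator (fun y => g y ^ 2) (quantile P₀ (x ^ (-t)))
            + A.indicator (fun y => g y ^ 2) (quantile P₀ (1 - x ^ (-t))))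
        ≤ (Icc a₀ 1).indicator
          (fun _ => ENNReal.ofReal (2 * Real.log x * x ^ (2 * b + 2 * δ - 1))) t := by
      filter_upwards [ae_restrict_of_ae hzero, ae_restrict_mem measurableSet_Ici] with t h1 ht
      obtain ⟨m1, m2⟩ := hmem t ht
      rcases lt_or_ge t 1 with h | h
      · rw [indicator_of_mem (m1.2 h), indicator_of_mem (m2.2 h),
          indicator_of_mem (mem_Icc.2 ⟨ht, h.le⟩)]
        have hp := h1 ht
        rw [min_eq_left h.le] at hp
        have hp2 : ∀ z : ℝ≥0∞, z ≤ peak P₀ g x t →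
            z ^ 2 ≤ ENNReal.ofReal (x ^ (2 * b + 2 * δ - 1 + t)) := by
          intro z hz
          calc z ^ 2 ≤ ENNReal.ofReal (x ^ (b + δ - 1 / 2 + t - t / 2)) ^ 2 :=
                pow_le_pow_left₀ zero_le (hz.trans hp) 2
            _ = _ := by
                rw [← ENNReal.ofReal_pow (by positivity), ← Real.rpow_natCast,
                  ← Real.rpow_mul hx0.le]
                congr 2; push_cast; ring
        refine (mul_le_mul_right (add_le_add (hp2 _ (le_max_left _ _))
          (hp2 _ (le_max_right _ _))) _).trans (le_of_eq ?_)
        rw [← ENNReal.ofReal_add (by positivity) (by positivity),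
          ← ENNReal.ofReal_mul (by positivity)]
        congr 1
        rw [show 2 * b + 2 * δ - 1 = -t + (2 * b + 2 * δ - 1 + t) by ring, Real.rpow_add hx0 (-t)]
        ring_nf
      · rw [indicator_of_notMem (fun hh => absurd (m1.1 hh) (not_lt.2 h)),
          indicator_of_notMem (fun hh => absurd (m2.1 hh) (not_lt.2 h))]
        simp
    refine (lintegral_mono_ae hstep).trans ((setLIntegral_le_lintegral _ _).trans ?_)
    rw [lintegral_indicator measurableSet_Icc, setLIntegral_const, Real.volume_Icc]
    refine mul_le_of_le_one_right zero_le ?_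
    rw [ENNReal.ofReal_le_one]
    have : 0 ≤ a₀ := (div_pos (Real.log_pos (by norm_num)) hL).le
    linarith
  · rw [withDensity_apply _ hA.compl, ← lintegral_indicator hA.compl,
      lintegral_eq_quantile hx1 (hg.indicator hA.compl)]
    have hstep : ∀ t ∈ Ici a₀, ENNReal.ofReal (Real.log x * x ^ (-t)) *
          (Aᶜ.indicator g (quantile P₀ (x ^ (-t)))
            + Aᶜ.indicator g (quantile P₀ (1 - x ^ (-t))))
        ≤ (Ici 1).indicator (fun t => ENNReal.ofReal (2 * Real.log x) *
            (ENNReal.ofReal (x ^ (-t)) * peak P₀ g x t)) t := by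
      intro t ht
      obtain ⟨m1, m2⟩ := hmem t ht
      rcases lt_or_ge t 1 with h | h
      · rw [indicator_of_notMem (notMem_compl_iff.2 (m1.2 h)),
          indicator_of_notMem (notMem_compl_iff.2 (m2.2 h))]
        simp
      · rw [indicator_of_mem (mem_Ici.2 h)]
        rw [ENNReal.ofReal_mul hL.le, ENNReal.ofReal_mul zero_le_two, ENNReal.ofReal_ofNat]
        have hle : Aᶜ.indicator g (quantile P₀ (x ^ (-t)))
            + Aᶜ.indicator g (quantile P₀ (1 - x ^ (-t))) ≤ peak P₀ g x t + peak P₀ g x t :=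
          add_le_add ((indicator_le_self Aᶜ g _).trans (le_max_left _ _))
            ((indicator_le_self Aᶜ g _).trans (le_max_right _ _))
        refine (mul_le_mul_right hle _).trans (le_of_eq ?_)
        ring
    refine (setLIntegral_mono' measurableSet_Ici hstep).trans
      ((setLIntegral_le_lintegral _ _).trans ?_)
    rw [lintegral_indicator measurableSet_Ici, lintegral_const_mul' _ _ ENNReal.ofReal_ne_top,
      ENNReal.ofReal_mul (mul_nonneg zero_le_two hL.le)]
    exact mul_le_mul_right hextreme _

variable {f : ℕ → ℝ → ℝ≥0∞}

/-- Above the threshold, the truncated second moment method applies. -/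
theorem undetectable_of_upper_bounds [NullSingletonClass P₀] (hf : ∀ n, Measurable (f n))
    [∀ n, IsProbabilityMeasure (P₀.withDensity (f n))] {β b M : ℝ} (hβ : 0 < β) (hβb : b < β)
    (hM : 1 ≤ M)
    (hzero : ∀ δ : ℝ, 0 < δ → ∀ᶠ n : ℕ in atTop, ∀ᵐ t : ℝ, Real.log 2 / Real.log n ≤ t →
      peak P₀ (f n) n t ≤ ENNReal.ofReal ((n : ℝ) ^ (b + δ - 1 / 2 + t - min t 1 / 2)))
    (htail : ∀ δ : ℝ, 0 < δ → ∀ᶠ n : ℕ in atTop,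
      ∫⁻ t in Ici M, ENNReal.ofReal ((n : ℝ) ^ (-t)) * peak P₀ (f n) n t
        ≤ ENNReal.ofReal ((n : ℝ) ^ (b - 1 + δ))) :
    Undetectable P₀ (fun n => P₀.withDensity (f n)) β := by
  intro φ hφ hφ01
  set δ := (β - b) / 2 with hδ
  have hδ0 : 0 < δ := by rw [hδ]; linarith
  have hη : Tendsto (fun n : ℕ => 2 * M * (Real.log n * (n : ℝ) ^ (-δ))) atTop (𝓝 0) := by
    have := (tendsto_log_mul_rpow_neg hδ0).const_mul (2 * M)
    rwa [mul_zero] at this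
  have hζ : Tendsto (fun n : ℕ => 2 * (Real.log n * (n : ℝ) ^ (-(2 * δ)))) atTop (𝓝 0) := by
    have := (tendsto_log_mul_rpow_neg (show 0 < 2 * δ by linarith)).const_mul 2
    rwa [mul_zero] at this
  have hlim : Tendsto (fun n : ℕ => 2 * M * (Real.log n * (n : ℝ) ^ (-δ))
      + √(Real.exp (2 * (Real.log n * (n : ℝ) ^ (-(2 * δ)))) - 1
        + 2 * (2 * M * (Real.log n * (n : ℝ) ^ (-δ))))) atTop (𝓝 0) := by
    have h1 := (((Real.continuous_exp.tendsto 0).comp hζ).sub_const 1).add (hη.const_mul 2)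
    have h2 := hη.add ((Real.continuous_sqrt.tendsto _).comp h1)
    simpa using h2
  rw [tendsto_iff_dist_tendsto_zero]
  refine squeeze_zero' (Eventually.of_forall fun _ => dist_nonneg) ?_ hlim
  filter_upwards [hzero δ hδ0, htail δ hδ0, eventually_ge_atTop 3] with n h1 h2 h3
  have hn3 : (3 : ℝ) ≤ n := by exact_mod_cast h3
  have hn0 : (0 : ℝ) < n := by linarith
  have hL : 0 < Real.log n := Real.log_pos (by linarith)
  obtain ⟨A, hA, hV, hW⟩ := truncation_bounds (hf n) hn3 h1
    (lintegral_extreme_le hM (by linarith) h1 h2)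
  obtain ⟨hε0, hε1⟩ := rpow_neg_nonneg_le_one hβ n
  have hbound := abs_error_sum_mixture_le (hf n) hε0 hε1 hA (by positivity) (by positivity) hV hW n
    (hφ n) (hφ01 n)
  have e1 : n * (n : ℝ) ^ (-β) * (2 * Real.log n * (M * (n : ℝ) ^ (b - 1 + δ)))
      = 2 * M * (Real.log n * (n : ℝ) ^ (-δ)) := by
    have : (n : ℝ) ^ (-δ) = n * ((n : ℝ) ^ (-β) * (n : ℝ) ^ (b - 1 + δ)) := by
      nth_rewrite 2 [← Real.rpow_one (n : ℝ)]
      rw [← Real.rpow_add hn0, ← Real.rpow_add hn0]; congr 1; rw [hδ]; ring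
    rw [this]; ring
  have e2 : n * ((n : ℝ) ^ (-β)) ^ 2 * (2 * Real.log n * (n : ℝ) ^ (2 * b + 2 * δ - 1))
      = 2 * (Real.log n * (n : ℝ) ^ (-(2 * δ))) := by
    have : (n : ℝ) ^ (-(2 * δ))
        = n * ((n : ℝ) ^ (-β) * ((n : ℝ) ^ (-β) * (n : ℝ) ^ (2 * b + 2 * δ - 1))) := by
      nth_rewrite 2 [← Real.rpow_one (n : ℝ)]
      rw [← Real.rpow_add hn0, ← Real.rpow_add hn0, ← Real.rpow_add hn0]; congr 1; rw [hδ]; ring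
    rw [this]; ring
  rw [e1, e2] at hbound
  exact hbound

/-- The threshold is at least `1 / 2`, since otherwise the total mass of the densities would
tend to `0`. -/
lemma half_le_of_upper_bounds (hf : ∀ n, Measurable (f n))
    [∀ n, IsProbabilityMeasure (P₀.withDensity (f n))] {b M : ℝ} (hM : 1 ≤ M)
    (hzero : ∀ δ : ℝ, 0 < δ → ∀ᶠ n : ℕ in atTop, ∀ᵐ t : ℝ, Real.log 2 / Real.log n ≤ t →
      peak P₀ (f n) n t ≤ ENNReal.ofReal ((n : ℝ) ^ (b + δ - 1 / 2 + t - min t 1 / 2)))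
    (htail : ∀ δ : ℝ, 0 < δ → ∀ᶠ n : ℕ in atTop,
      ∫⁻ t in Ici M, ENNReal.ofReal ((n : ℝ) ^ (-t)) * peak P₀ (f n) n t
        ≤ ENNReal.ofReal ((n : ℝ) ^ (b - 1 + δ))) : 1 / 2 ≤ b := by
  by_contra! hb
  set δ := (1 / 2 - b) / 2 with hδ
  have hδ0 : 0 < δ := by rw [hδ]; linarith
  have hlim : Tendsto (fun n : ℕ => 2 * (1 + M) * (Real.log n * (n : ℝ) ^ (-δ))) atTop (𝓝 0) := by
    have := (tendsto_log_mul_rpow_neg hδ0).const_mul (2 * (1 + M))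
    rwa [mul_zero] at this
  obtain ⟨n, h1, h2, h3, h4⟩ := ((hzero δ hδ0).and ((htail δ hδ0).and
    ((eventually_ge_atTop 2).and (hlim.eventually_lt_const one_pos)))).exists
  have hn2 : (2 : ℝ) ≤ n := by exact_mod_cast h3
  have hn0 : (0 : ℝ) < n := by linarith
  have hn1 : (1 : ℝ) < n := by linarith
  have hL : 0 < Real.log n := Real.log_pos hn1
  have ha1 := log_two_div_log_le_one hn2
  set a₀ := Real.log 2 / Real.log n with ha₀
  have ha0 : 0 ≤ a₀ := (div_pos (Real.log_pos (by norm_num)) hL).le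
  have hext := lintegral_extreme_le hM hn2 h1 h2
  have hmid : ∫⁻ t in Icc a₀ 1, ENNReal.ofReal ((n : ℝ) ^ (-t)) * peak P₀ (f n) n t
      ≤ ENNReal.ofReal ((n : ℝ) ^ (-δ)) := by
    calc _ ≤ ∫⁻ _ in Icc a₀ 1, ENNReal.ofReal ((n : ℝ) ^ (-δ)) := by
          refine lintegral_mono_ae ?_
          filter_upwards [ae_restrict_of_ae h1, ae_restrict_mem measurableSet_Icc] with t k1 k2
          refine (mul_le_mul_right (k1 k2.1) _).trans ?_
          rw [← ENNReal.ofReal_mul (by positivity), ← Real.rpow_add hn0, min_eq_left k2.2]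
          refine ENNReal.ofReal_le_ofReal (Real.rpow_le_rpow_of_exponent_le hn1.le ?_)
          have := ha0.trans k2.1
          rw [hδ]; linarith
      _ ≤ _ := by
          rw [setLIntegral_const, Real.volume_Icc]
          refine mul_le_of_le_one_right zero_le ?_
          rw [ENNReal.ofReal_le_one]; linarith
  have hsub : Ici a₀ ⊆ Icc a₀ 1 ∪ Ici 1 := fun t ht =>
    (le_total t 1).imp (fun h => ⟨ht, h⟩) id
  have hext' : ENNReal.ofReal (M * (n : ℝ) ^ (b - 1 + δ))
      ≤ ENNReal.ofReal (M * (n : ℝ) ^ (-δ)) := by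
    refine ENNReal.ofReal_le_ofReal (mul_le_mul_of_nonneg_left ?_ (by linarith))
    refine Real.rpow_le_rpow_of_exponent_le hn1.le ?_
    rw [hδ]; linarith
  have htotal : ∫⁻ y, f n y ∂P₀ = 1 := by
    rw [← setLIntegral_univ, ← withDensity_apply _ MeasurableSet.univ]
    exact measure_univ
  have hle := lintegral_le_peak (P₀ := P₀) hn1 (hf n)
  have hsum := (lintegral_mono_set hsub).trans ((lintegral_union_le
    (μ := volume) (fun t => ENNReal.ofReal ((n : ℝ) ^ (-t)) * peak P₀ (f n) n t) _ _).trans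
    (add_le_add hmid (hext.trans hext')))
  have hfin := hle.trans (mul_le_mul_right hsum _)
  rw [htotal, ← ENNReal.ofReal_add (by positivity) (by positivity),
    ← ENNReal.ofReal_mul (by positivity), ← ENNReal.ofReal_one,
    ENNReal.ofReal_le_ofReal_iff (by positivity)] at hfin
  have : 2 * Real.log n * ((n : ℝ) ^ (-δ) + M * (n : ℝ) ^ (-δ))
      = 2 * (1 + M) * (Real.log n * (n : ℝ) ^ (-δ)) := by ring
  linarith

/-- The threshold is at most `1`, since otherwise some tail would carry a mass larger than `1`. -/
lemma le_one_of_lower_bounds (hf : ∀ n, Measurable (f n))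
    [∀ n, IsProbabilityMeasure (P₀.withDensity (f n))] {b : ℝ}
    (hpos : ∀ δ : ℝ, 0 < δ → ∃ m : ℝ, 0 < m ∧ ∀ᶠ n : ℕ in atTop,
      ENNReal.ofReal m ≤ volume {t : ℝ | Real.log 2 / Real.log n ≤ t ∧
        ENNReal.ofReal ((n : ℝ) ^ (b - δ - 1 / 2 + t - min t 1 / 2)) ≤ peak P₀ (f n) n t}) :
    b ≤ 1 := by
  by_contra! hb
  set δ := (b - 1) / 2 with hδ
  have hδ0 : 0 < δ := by rw [hδ]; linarith
  obtain ⟨m, hm, hmn⟩ := hpos δ hδ0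
  obtain ⟨J, hJ⟩ := exists_nat_gt (1 / (2 * δ))
  have hJ0 : (0 : ℝ) < J := lt_trans (by positivity) hJ
  have hJδ : 1 / (2 * (J : ℝ)) ≤ δ := by
    rw [div_lt_iff₀ (by positivity)] at hJ
    rw [div_le_iff₀ (by positivity)]
    linarith
  have hc0 : 0 < m / (J + 1) := by positivity
  have hlog : Tendsto (fun n : ℕ => m / (J + 1) * Real.log n) atTop atTop :=
    (Real.tendsto_log_atTop.comp tendsto_natCast_atTop_atTop).const_mul_atTop hc0
  obtain ⟨n, hT, hn2, h2⟩ :=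
    (hmn.and ((eventually_ge_atTop 2).and (hlog.eventually_gt_atTop 2))).exists
  have hn2' : (2 : ℝ) ≤ n := by exact_mod_cast hn2
  obtain ⟨a, ⟨-, ha1⟩, hmass⟩ := exists_tail_mass hn2' (hf n) (Nat.cast_pos.1 hJ0) hT
  have hle := hmass.trans (add_le_add (prob_le_one (μ := P₀.withDensity (f n)))
    (prob_le_one (μ := P₀.withDensity (f n))))
  have h22 : (1 : ℝ≥0∞) + 1 = ENNReal.ofReal 2 := by rw [ENNReal.ofReal_ofNat]; norm_num
  rw [h22, ENNReal.ofReal_le_ofReal_iff zero_le_two] at hle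
  have hpow : 1 ≤ (n : ℝ) ^ (b - δ - 1 / 2 - a / 2 - 1 / (2 * J)) := by
    refine Real.one_le_rpow (by linarith) ?_
    linarith [show b - δ - 1 - δ = 0 by rw [hδ]; ring]
  have := le_mul_of_one_le_right (show 0 ≤ m / (J + 1) * Real.log n by linarith) hpow
  rw [mul_assoc] at this
  linarith

end UpperBounds

/-! ### Translation of the hypotheses on `h` -/

lemma h_eq_log_peak (P₀ : Measure ℝ) (f : ℕ → ℝ → ℝ≥0∞) (n : ℕ) (t : ℝ) :
    h P₀ f n t = ENNReal.log (peak P₀ (f n) n t) :=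
  (ENNReal.log_monotone.map_max).symm

lemma coe_le_log_div_iff {x : ℝ} (hx : 1 < x) (p : ℝ≥0∞) (c t m : ℝ) :
    (c : EReal) ≤ ENNReal.log p / ((Real.log x : ℝ) : EReal) - (t : EReal) + (m : EReal)
      ↔ ENNReal.ofReal (x ^ (c + t - m)) ≤ p := by
  have hL := Real.log_pos hx
  have hx0 : 0 < x := by linarith
  have hLE : (0 : EReal) < ((Real.log x : ℝ) : EReal) := EReal.coe_pos.2 hL
  rcases eq_or_ne p 0 with rfl | h0
  · rw [ENNReal.log_zero, EReal.bot_div_of_pos_ne_top hLE (EReal.coe_ne_top _)]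
    simp [Real.rpow_pos_of_pos hx0]
  rcases eq_or_ne p ∞ with rfl | htop
  · rw [ENNReal.log_top, EReal.top_div_of_pos_ne_top hLE (EReal.coe_ne_top _)]
    simp
  · have hr : 0 < p.toReal := ENNReal.toReal_pos h0 htop
    rw [ENNReal.log_pos_real h0 htop, ← EReal.coe_div, ← EReal.coe_sub, ← EReal.coe_add,
      EReal.coe_le_coe_iff, ENNReal.ofReal_le_iff_le_toReal htop, Real.rpow_def_of_pos hx0,
      ← Real.le_log_iff_exp_le hr, ← le_div_iff₀' hL]
    constructor <;> intro h <;> linarith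

/-- An absolute deviation below `η` on the logarithmic scale sandwiches the density. -/
lemma sandwich_of_abs_log_div_lt {x : ℝ} (hx : 1 < x) {p : ℝ≥0∞} {γ η : ℝ}
    (h : (ENNReal.log p / ((Real.log x : ℝ) : EReal) - (γ : EReal)).abs < ENNReal.ofReal η) :
    ENNReal.ofReal (x ^ (γ - η)) ≤ p ∧ p ≤ ENNReal.ofReal (x ^ (γ + η)) := by
  have hL := Real.log_pos hx
  have hx0 : 0 < x := by linarith
  have hLE : (0 : EReal) < ((Real.log x : ℝ) : EReal) := EReal.coe_pos.2 hL
  rcases eq_or_ne p 0 with rfl | h0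
  · rw [ENNReal.log_zero, EReal.bot_div_of_pos_ne_top hLE (EReal.coe_ne_top _)] at h
    simp at h
  rcases eq_or_ne p ∞ with rfl | htop
  · rw [ENNReal.log_top, EReal.top_div_of_pos_ne_top hLE (EReal.coe_ne_top _)] at h
    simp at h
  · have hr : 0 < p.toReal := ENNReal.toReal_pos h0 htop
    rw [ENNReal.log_pos_real h0 htop, ← EReal.coe_div, ← EReal.coe_sub, EReal.abs_def] at h
    have habs := abs_lt.1 ((ENNReal.ofReal_lt_ofReal_iff_of_nonneg (abs_nonneg _)).1 h)
    constructor
    · rw [ENNReal.ofReal_le_iff_le_toReal htop, Real.rpow_def_of_pos hx0,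
        ← Real.le_log_iff_exp_le hr, ← le_div_iff₀' hL]
      linarith [habs.1]
    · rw [ENNReal.le_ofReal_iff_toReal_le htop (by positivity), Real.rpow_def_of_pos hx0,
        ← Real.log_le_iff_le_exp hr, ← div_le_iff₀' hL]
      linarith [habs.2]

/-! ### The far tail -/

lemma lintegral_exp_neg_mul_le {l M : ℝ} (hl : 0 < l) (hM : 0 ≤ M) :
    ∫⁻ t in Ici M, ENNReal.ofReal (Real.exp (-l * t)) ≤ ENNReal.ofReal (1 / l) := by
  rw [setLIntegral_congr Ioi_ae_eq_Ici.symm]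
  refine (lintegral_mono_set (Ioi_subset_Ioi hM)).trans ?_
  rw [← ofReal_integral_eq_lintegral_ofReal (integrableOn_exp_mul_Ioi (by linarith) 0)
    (ae_of_all _ fun t => (Real.exp_pos _).le), integral_exp_mul_Ioi (by linarith)]
  refine ENNReal.ofReal_le_ofReal (le_of_eq ?_)
  simp

section Tail

variable {P₀ : Measure ℝ} {f : ℕ → ℝ → ℝ≥0∞} {b M : ℝ}

/-- Exponential damping at a rate `λ_n` that decays slower than any power of `n`. -/
lemma tail_of_damping {lam : ℕ → ℝ} (hlam_pos : ∀ n, 0 < lam n)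
    (hlam : ∀ κ : ℝ, 0 < κ → Tendsto (fun n : ℕ => lam n * (n : ℝ) ^ κ) atTop atTop)
    (hM : 1 ≤ M)
    (hdamp : ∀ δ : ℝ, 0 < δ → ∀ᶠ n : ℕ in atTop, ∀ᵐ t : ℝ, M ≤ t →
      peak P₀ (f n) n t
        ≤ ENNReal.ofReal ((n : ℝ) ^ (b + δ - 1 + (1 - lam n / Real.log n) * t))) :
    ∀ δ : ℝ, 0 < δ → ∀ᶠ n : ℕ in atTop,
      ∫⁻ t in Ici M, ENNReal.ofReal ((n : ℝ) ^ (-t)) * peak P₀ (f n) n t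
        ≤ ENNReal.ofReal ((n : ℝ) ^ (b - 1 + δ)) := by
  intro δ hδ
  filter_upwards [hdamp (δ / 2) (by linarith), eventually_ge_atTop 2,
    (hlam (δ / 2) (by linarith)).eventually_ge_atTop 1] with n h1 h2 h3
  have hn2 : (2 : ℝ) ≤ n := by exact_mod_cast h2
  have hn0 : (0 : ℝ) < n := by linarith
  have hL : 0 < Real.log n := Real.log_pos (by linarith)
  have hl := hlam_pos n
  calc _ ≤ ∫⁻ t in Ici M, ENNReal.ofReal ((n : ℝ) ^ (b - 1 + δ / 2)) *
        ENNReal.ofReal (Real.exp (-lam n * t)) := by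
        refine lintegral_mono_ae ?_
        filter_upwards [ae_restrict_of_ae h1, ae_restrict_mem measurableSet_Ici] with t k1 k2
        refine (mul_le_mul_right (k1 k2) _).trans (le_of_eq ?_)
        rw [← ENNReal.ofReal_mul (by positivity), ← ENNReal.ofReal_mul (by positivity),
          ← Real.rpow_add hn0]
        congr 1
        rw [Real.rpow_def_of_pos hn0, Real.rpow_def_of_pos hn0, ← Real.exp_add]
        congr 1
        field_simp
        ring
    _ = ENNReal.ofReal ((n : ℝ) ^ (b - 1 + δ / 2)) *
        ∫⁻ t in Ici M, ENNReal.ofReal (Real.exp (-lam n * t)) :=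
        lintegral_const_mul' _ _ ENNReal.ofReal_ne_top
    _ ≤ ENNReal.ofReal ((n : ℝ) ^ (b - 1 + δ / 2)) * ENNReal.ofReal ((n : ℝ) ^ (δ / 2)) := by
        gcongr
        refine (lintegral_exp_neg_mul_le hl (by linarith)).trans (ENNReal.ofReal_le_ofReal ?_)
        rw [div_le_iff₀ hl]
        linarith
    _ = _ := by
        rw [← ENNReal.ofReal_mul (by positivity), ← Real.rpow_add hn0]
        congr 2; ring

/-- Uniform convergence of `h_n / log n`: the tail at `n` is compared with the integrable tail at a
fixed index `N`. With `x = γ t - t` one has `n ^ x = (n / N) ^ x * N ^ x`, and `x` is bounded above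
by `b - 1` up to a small error. -/
lemma tail_of_uniform [IsProbabilityMeasure P₀] (hf : ∀ n, Measurable (f n))
    [∀ n, IsProbabilityMeasure (P₀.withDensity (f n))] (hM : 1 ≤ M)
    (hzero : ∀ δ : ℝ, 0 < δ → ∀ᶠ n : ℕ in atTop, ∀ᵐ t : ℝ, Real.log 2 / Real.log n ≤ t →
      peak P₀ (f n) n t ≤ ENNReal.ofReal ((n : ℝ) ^ (b + δ - 1 / 2 + t - min t 1 / 2)))
    {γ : ℝ → ℝ}
    (hunif : ∀ η : ℝ, 0 < η → ∀ᶠ n : ℕ in atTop, ∀ t, M ≤ t →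
      ENNReal.ofReal ((n : ℝ) ^ (γ t - η)) ≤ peak P₀ (f n) n t ∧
        peak P₀ (f n) n t ≤ ENNReal.ofReal ((n : ℝ) ^ (γ t + η))) :
    ∀ δ : ℝ, 0 < δ → ∀ᶠ n : ℕ in atTop,
      ∫⁻ t in Ici M, ENNReal.ofReal ((n : ℝ) ^ (-t)) * peak P₀ (f n) n t
        ≤ ENNReal.ofReal ((n : ℝ) ^ (b - 1 + δ)) := by
  intro δ hδ
  set η := δ / 4 with hη
  have hη0 : 0 < η := by rw [hη]; linarith
  obtain ⟨N, hN1, hN2, hN3⟩ := ((hunif η hη0).and ((hzero η hη0).and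
    (eventually_ge_atTop 2))).exists
  have hN2' : (2 : ℝ) ≤ N := by exact_mod_cast hN3
  have hN0 : (0 : ℝ) < N := by linarith
  have hNone : (1 : ℝ) < N := by linarith
  have hLN : 0 < Real.log N := Real.log_pos hNone
  have ha1 := log_two_div_log_le_one hN2'
  set I := ∫⁻ t in Ici M, ENNReal.ofReal ((N : ℝ) ^ (-t)) * peak P₀ (f N) N t with hI
  have hIle : I ≤ ENNReal.ofReal (1 / Real.log N) := by
    have htotal : ∫⁻ y, f N y ∂P₀ = 1 := by
      rw [← setLIntegral_univ, ← withDensity_apply _ MeasurableSet.univ]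
      exact measure_univ
    have h1 := lintegral_peak_le (P₀ := P₀) hNone (hf N)
    rw [htotal] at h1
    have h2 : ENNReal.ofReal (Real.log N) * I ≤ 1 :=
      (mul_le_mul_right (lintegral_mono_set (Ici_subset_Ici.2 (ha1.trans hM))) _).trans h1
    rw [one_div, ENNReal.ofReal_inv_of_pos hLN, ENNReal.le_inv_iff_mul_le, mul_comm]
    exact h2
  set C := (N : ℝ) ^ η * ((N : ℝ) ^ (b - 1 + 2 * η))⁻¹ with hC
  have hC0 : 0 < C := by positivity
  filter_upwards [hunif η hη0, eventually_ge_atTop N,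
    (tendsto_natCast_rpow_atTop hη0).eventually_ge_atTop (C * (1 / Real.log N))] with n h1 h2 h3
  have hnN : (N : ℝ) ≤ n := by exact_mod_cast h2
  have hn0 : (0 : ℝ) < n := by linarith
  calc _ ≤ ∫⁻ t in Ici M, ENNReal.ofReal (C * (n : ℝ) ^ (b - 1 + 3 * η)) *
        (ENNReal.ofReal ((N : ℝ) ^ (-t)) * peak P₀ (f N) N t) := by
        refine lintegral_mono_ae ?_
        filter_upwards [ae_restrict_of_ae hN2, ae_restrict_mem measurableSet_Ici] with t k1 k2
        have k3 := k1 (ha1.trans (hM.trans k2))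
        rw [min_eq_right (hM.trans k2)] at k3
        obtain ⟨k4, -⟩ := hN1 t k2
        have k5 := k4.trans k3
        rw [ENNReal.ofReal_le_ofReal_iff (by positivity), Real.rpow_le_rpow_left_iff hNone] at k5
        have hx : γ t - t ≤ b - 1 + 2 * η := by linarith
        refine (mul_le_mul_right (h1 t k2).2 _).trans ?_
        refine le_trans ?_ (mul_le_mul_right (mul_le_mul_right k4 _) _)
        rw [← ENNReal.ofReal_mul (by positivity), ← ENNReal.ofReal_mul (by positivity),
          ← ENNReal.ofReal_mul (by positivity)]
        refine ENNReal.ofReal_le_ofReal ?_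
        have hratio : ((n : ℝ) / N) ^ (γ t - t) ≤ ((n : ℝ) / N) ^ (b - 1 + 2 * η) :=
          Real.rpow_le_rpow_of_exponent_le ((one_le_div hN0).2 hnN) hx
        rw [Real.div_rpow hn0.le hN0.le, Real.div_rpow hn0.le hN0.le,
          div_le_iff₀ (by positivity)] at hratio
        calc (n : ℝ) ^ (-t) * (n : ℝ) ^ (γ t + η) = (n : ℝ) ^ (γ t - t) * (n : ℝ) ^ η := by
              rw [← Real.rpow_add hn0, ← Real.rpow_add hn0]; congr 1; ring
          _ ≤ (n : ℝ) ^ (b - 1 + 2 * η) / (N : ℝ) ^ (b - 1 + 2 * η) * (N : ℝ) ^ (γ t - t)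
              * (n : ℝ) ^ η := by gcongr
          _ = C * (n : ℝ) ^ (b - 1 + 3 * η) * ((N : ℝ) ^ (-t) * (N : ℝ) ^ (γ t - η)) := by
              have e1 : (n : ℝ) ^ (b - 1 + 3 * η) = (n : ℝ) ^ (b - 1 + 2 * η) * (n : ℝ) ^ η := by
                rw [← Real.rpow_add hn0]; congr 1; ring
              have e2 : (N : ℝ) ^ (γ t - t)
                  = (N : ℝ) ^ η * ((N : ℝ) ^ (-t) * (N : ℝ) ^ (γ t - η)) := by
                rw [← Real.rpow_add hN0, ← Real.rpow_add hN0]; congr 1; ring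
              rw [e1, e2, hC]; ring
    _ = ENNReal.ofReal (C * (n : ℝ) ^ (b - 1 + 3 * η)) * I :=
        lintegral_const_mul' _ _ ENNReal.ofReal_ne_top
    _ ≤ ENNReal.ofReal (C * (n : ℝ) ^ (b - 1 + 3 * η)) * ENNReal.ofReal (1 / Real.log N) := by
        gcongr
    _ ≤ _ := by
        rw [← ENNReal.ofReal_mul (by positivity)]
        refine ENNReal.ofReal_le_ofReal ?_
        calc C * (n : ℝ) ^ (b - 1 + 3 * η) * (1 / Real.log N)
            = C * (1 / Real.log N) * (n : ℝ) ^ (b - 1 + 3 * η) := by ring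
          _ ≤ (n : ℝ) ^ η * (n : ℝ) ^ (b - 1 + 3 * η) := by gcongr
          _ = _ := by rw [← Real.rpow_add hn0]; congr 1; rw [hη]; ring

end Tail

end SparseMixture

theorem theorem4p3
    (P₀ : Measure ℝ) [IsProbabilityMeasure P₀] [NullSingletonClass P₀]
    (μ : ℕ → Measure ℝ) [∀ n, IsProbabilityMeasure (μ n)]
    -- `f n` is any version of the density of `μ n` with respect to `P₀`
    (f : ℕ → ℝ → ℝ≥0∞) (hf : ∀ n, Measurable (f n)) (hμ : ∀ n, μ n = P₀.withDensity (f n))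
    (βs : ℝ)
    (hpos : ∀ δ : ℝ, 0 < δ →
      0 < liminf (fun n : ℕ => volume {t : ℝ | Real.log 2 / Real.log n ≤ t ∧
        ((βs - δ - 1 / 2 : ℝ) : EReal) ≤
          SparseMixture.h P₀ f n t / ((Real.log n : ℝ) : EReal) - (t : EReal)
            + ((min t 1 / 2 : ℝ) : EReal)}) atTop)
    (hzero : ∀ δ : ℝ, 0 < δ → ∀ᶠ n : ℕ in atTop,
      volume {t : ℝ | Real.log 2 / Real.log n ≤ t ∧
        ((βs + δ - 1 / 2 : ℝ) : EReal) ≤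
          SparseMixture.h P₀ f n t / ((Real.log n : ℝ) : EReal) - (t : EReal)
            + ((min t 1 / 2 : ℝ) : EReal)} = 0)
    (lam : ℕ → ℝ) (hlam_pos : ∀ n, 0 < lam n) (hlam_zero : Tendsto lam atTop (𝓝 0))
    (hlam : ∀ κ : ℝ, 0 < κ → Tendsto (fun n : ℕ => lam n * (n : ℝ) ^ κ) atTop atTop)
    (M : ℝ) (hM : 1 ≤ M)
    (htail :
      (∃ γ : ℝ → ℝ, Tendsto (fun n : ℕ => ⨆ t ∈ Ici M,
        (SparseMixture.h P₀ f n t / ((Real.log n : ℝ) : EReal) - ((γ t : ℝ) : EReal)).abs)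
          atTop (𝓝 0)) ∨
      (∀ δ : ℝ, 0 < δ → ∀ᶠ n : ℕ in atTop,
        volume {t : ℝ | M ≤ t ∧
          ((βs + δ - 1 : ℝ) : EReal) ≤
            SparseMixture.h P₀ f n t / ((Real.log n : ℝ) : EReal)
              - (((1 - lam n / Real.log n) * t : ℝ) : EReal)} = 0)) :
    SparseMixture.IsDetectionThreshold P₀ μ βs ∧
    ∀ β ∈ Ioc (1 / 2 : ℝ) 1, β < βs → ∀ s : ℝ, ∃ c : ℕ → ℝ,
      SparseMixture.CompletelySeparates P₀ μ β fun n =>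
        {x | ((c n : ℝ) : EReal) < SparseMixture.S P₀ s x} := by
  obtain rfl : μ = fun n => P₀.withDensity (f n) := funext hμ
  have hn1 : ∀ᶠ n : ℕ in atTop, (1 : ℝ) < n := by
    filter_upwards [eventually_ge_atTop 2] with n hn
    exact_mod_cast hn
  have hpos' : ∀ δ : ℝ, 0 < δ → ∃ m : ℝ, 0 < m ∧ ∀ᶠ n : ℕ in atTop,
      ENNReal.ofReal m ≤ volume {t : ℝ | Real.log 2 / Real.log n ≤ t ∧
        ENNReal.ofReal ((n : ℝ) ^ (βs - δ - 1 / 2 + t - min t 1 / 2))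
          ≤ SparseMixture.peak P₀ (f n) n t} := by
    intro δ hδ
    obtain ⟨m, hm0, hm⟩ := ENNReal.lt_iff_exists_nnreal_btwn.1 (hpos δ hδ)
    refine ⟨m, by exact_mod_cast hm0, ?_⟩
    filter_upwards [eventually_lt_of_lt_liminf hm, hn1] with n h1 h2
    rw [ENNReal.ofReal_coe_nnreal]
    refine h1.le.trans (measure_mono fun t ht => ⟨ht.1, ?_⟩)
    rw [← SparseMixture.coe_le_log_div_iff h2, ← SparseMixture.h_eq_log_peak]
    exact ht.2
  have hzero' : ∀ δ : ℝ, 0 < δ → ∀ᶠ n : ℕ in atTop, ∀ᵐ t : ℝ, Real.log 2 / Real.log n ≤ t →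
      SparseMixture.peak P₀ (f n) n t
        ≤ ENNReal.ofReal ((n : ℝ) ^ (βs + δ - 1 / 2 + t - min t 1 / 2)) := by
    intro δ hδ
    filter_upwards [hzero δ hδ, hn1] with n h1 h2
    refine ae_iff.2 (measure_mono_null (fun t ht => ?_) h1)
    obtain ⟨ht1, ht2⟩ := Classical.not_imp.1 (show ¬ (_ → _) from ht)
    refine ⟨ht1, ?_⟩
    rw [SparseMixture.h_eq_log_peak, SparseMixture.coe_le_log_div_iff h2]
    exact (not_le.1 ht2).le
  have htail' : ∀ δ : ℝ, 0 < δ → ∀ᶠ n : ℕ in atTop,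
      ∫⁻ t in Ici M, ENNReal.ofReal ((n : ℝ) ^ (-t)) * SparseMixture.peak P₀ (f n) n t
        ≤ ENNReal.ofReal ((n : ℝ) ^ (βs - 1 + δ)) := by
    rcases htail with ⟨γ, hγ⟩ | hdamp
    · refine SparseMixture.tail_of_uniform hf hM hzero' (γ := γ) fun η hη => ?_
      filter_upwards [hγ.eventually_lt_const (ENNReal.ofReal_pos.2 hη), hn1] with n h1 h2 t ht
      refine SparseMixture.sandwich_of_abs_log_div_lt h2 (lt_of_le_of_lt ?_ h1)
      rw [← SparseMixture.h_eq_log_peak]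
      exact le_iSup₂_of_le (f := fun t (_ : t ∈ Ici M) =>
        (SparseMixture.h P₀ f n t / ((Real.log n : ℝ) : EReal) - ((γ t : ℝ) : EReal)).abs)
        t ht le_rfl
    · refine SparseMixture.tail_of_damping hlam_pos hlam hM fun δ hδ => ?_
      filter_upwards [hdamp δ hδ, hn1] with n h1 h2
      refine ae_iff.2 (measure_mono_null (fun t ht => ?_) h1)
      obtain ⟨ht1, ht2⟩ := Classical.not_imp.1 (show ¬ (_ → _) from ht)
      refine ⟨ht1, ?_⟩
      have := (SparseMixture.coe_le_log_div_iff h2 (SparseMixture.peak P₀ (f n) n t)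
        (βs + δ - 1) ((1 - lam n / Real.log n) * t) 0).2 (by
          rw [sub_zero]; exact (not_le.1 ht2).le)
      rwa [EReal.coe_zero, add_zero, ← SparseMixture.h_eq_log_peak] at this
  have hsep : ∀ β ∈ Ioc (1 / 2 : ℝ) 1, β < βs → ∀ s : ℝ, ∃ c : ℕ → ℝ,
      SparseMixture.CompletelySeparates P₀ (fun n => P₀.withDensity (f n)) β fun n =>
        {x | ((c n : ℝ) : EReal) < SparseMixture.S P₀ s x} := by
    intro β hβ hlt s
    obtain ⟨κ, hκ, hsig⟩ := SparseMixture.eventually_signal hf hβ.1 hlt hpos'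
    exact SparseMixture.statistic_separates hβ.1 hκ hsig s
  refine ⟨⟨⟨SparseMixture.half_le_of_upper_bounds hf hM hzero' htail',
    SparseMixture.le_one_of_lower_bounds hf hpos'⟩, fun β hβ hlt => ?_, fun β hβ hlt => ?_⟩, hsep⟩
  · exact SparseMixture.undetectable_of_upper_bounds hf (by linarith [hβ.1]) hlt hM hzero' htail'
  · obtain ⟨c, hc⟩ := hsep β hβ hlt 2
    exact SparseMixture.LRDetectable.of_completelySeparates hf (fun n => rfl)
      (by linarith [hβ.1]) hc
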